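/- Let $(V,R,V^\vee,R^\vee)$ be a reduced crystallographic real root system such that $R$ spans $V$, with Weyl group $W\subset GL(V)$, and fix a $W$-invariant inner product $\langle\,,\,\rangle$ on $V$. Let $C(V)$ be the Clifford algebra of $V$ with relations $v^2=-\langle v,v\rangle$, let $\varepsilon$ be its parity automorphism and $a\mapsto a^t$ the anti-automorphism with $v^t=-v$ for $v\in V$, and let $\mathsf{Pin}(V)=\{a\in C(V)^\times:\varepsilon(a)Va^{-1}\subset V,\ a^t=a^{-1}\}$, with projection $p:\mathsf{Pin}(V)\to \mathsf{O}(V)$, $p(a)(v)=\varepsilon(a)va^{-1}$. Let $\widetilde W=p^{-1}(W)$, a double cover of $W$ acting on $V$ through $p$, and let $z=-1\in\widetilde W$. Let $S$ be a spin module, i.e. a simple complex $C(V)$-module, regarded as a representation of $\widetilde W$. For a finite group $\Gamma$ let $\mathcal R(\Gamma)$ be the complex vector space of virtual characters of $\Gamma$. For $\Gamma$ acting on $V$, let $\mathcal R_{\mathrm{ind}}(\Gamma)=\sum_{L}\mathrm{Ind}_L^\Gamma\mathcal R(L)$, the sum over subgroups $L\subset \Gamma$ with $V^L\ne0$, and let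 $e_\Gamma$ be the bilinear pairing on $\mathcal R(\Gamma)$ with $e_\Gamma(\sigma,\sigma')=\sum_{i\ge0}(-1)^i\dim\mathrm{Hom}_\Gamma(\bigwedge^iV\otimes\sigma,\sigma')$ for representations $\sigma,\sigma'$. Put $\overline{\mathcal R}(W)=\mathcal R(W)/\mathcal R_{\mathrm{ind}}(W)$, $\overline{\mathcal R}(\widetilde W)=\mathcal R(\widetilde W)/\mathrm{rad}(e_{\widetilde W})$, and let $\overline{\mathcal R}_{\mathsf{gen}}(\widetilde W)$ be the image in $\overline{\mathcal R}(\widetilde W)$ of the span of the irreducible representations of $\widetilde W$ on which $z$ acts by $-1$. Then $\sigma\mapsto\sigma\otimes S$ induces a well-defined linear map $\overline\iota_S:\overline{\mathcal R}(W)\to\overline{\mathcal R}_{\mathsf{gen}}(\widetilde W)$. If $\dim V$ is odd, then $\overline\iota_S$ is an isomorphism. If the root system is irreducible, then $\overline\iota_S$ is an isomorphism if and only if $\dim V$ is odd or $W$ is of type $A_n$ for some $n\geq 1$. -/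

import Mathlib

open scoped TensorProduct

noncomputable section

namespace SpinWeyl

/-! ### The representation space of a group and elliptic representations -/

section Elliptic

variable (Γ : Type*) [Group Γ]

/-- `R(Γ)`: the complex vector space of virtual characters, i.e. the `ℂ`-span, inside the functions
on `Γ`, of the characters of the finite dimensional complex representations of `Γ`. (Every such
representation is isomorphic to one on some `ℂ^n`.) -/
def repSpace : Submodule ℂ (Γ → ℂ) :=
  Submodule.span ℂ
    {f | ∃ (n : ℕ) (ρ : Representation ℂ Γ (Fin n → ℂ)), f = ρ.character}

/-- The average `|Γ|⁻¹ ∑_γ f(γ)` of a function over a finite group. (Only finite groups matter; the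
value is `0` if `Γ` is infinite.) -/
def average : (Γ → ℂ) →ₗ[ℂ] ℂ := by
  classical
  exact if h : Finite Γ then
      letI := Fintype.ofFinite Γ
      (Nat.card Γ : ℂ)⁻¹ • ∑ γ : Γ, LinearMap.proj γ
    else 0

variable {Γ}

/-- Extension by zero of a function on a subgroup. -/
def extendZero (L : Subgroup Γ) : (L → ℂ) →ₗ[ℂ] (Γ → ℂ) := by
  classical
  exact LinearMap.pi fun γ => if h : γ ∈ L then LinearMap.proj ⟨γ, h⟩ else 0

/-- Induction of (virtual) characters from a subgroup `L` of a finite group `Γ`: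
`(Ind f)(γ) = |L|⁻¹ ∑_{x ∈ Γ, x⁻¹γx ∈ L} f(x⁻¹γx)`. -/
def induction (L : Subgroup Γ) : (L → ℂ) →ₗ[ℂ] (Γ → ℂ) :=
  LinearMap.pi fun γ =>
    (L.index : ℂ) • (average Γ ∘ₗ
      LinearMap.funLeft ℂ ℂ (fun x : Γ => x⁻¹ * γ * x) ∘ₗ extendZero L)

variable {V : Type*} [AddCommGroup V] [Module ℝ V]

/-- `R_ind(Γ)`: the sum of the images of `Ind : R(L) → R(Γ)` over all subgroups `L` with
`V^L ≠ 0`. Here `Γ` acts linearly on the real vector space `V` through `π`. -/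
def inducedSpace (π : Γ →* (V ≃ₗ[ℝ] V)) : Submodule ℂ (Γ → ℂ) :=
  ⨆ (L : Subgroup Γ) (_ : ∃ v : V, v ≠ 0 ∧ ∀ l ∈ L, π l v = v),
    (repSpace L).map (induction L)

/-- The space `R(Γ) / R_ind(Γ)` of elliptic representations. -/
abbrev EllipticQuotient (π : Γ →* (V ≃ₗ[ℝ] V)) : Type _ :=
  repSpace Γ ⧸ (inducedSpace π).submoduleOf (repSpace Γ)

/-- The character of `Γ` on the `i`-th exterior power of `V`. -/
def extChar (π : Γ →* (V ≃ₗ[ℝ] V)) (i : ℕ) (γ : Γ) : ℂ :=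
  ((LinearMap.trace ℝ (⋀[ℝ]^i V) (exteriorPower.map i (π γ : V →ₗ[ℝ] V)) : ℝ) : ℂ)

/-- The elliptic pairing, i.e. the bilinear extension to virtual characters of
`e_Γ(σ, σ') = ∑_i (-1)^i dim Hom_Γ(⋀^i V ⊗ σ, σ')`. For characters `χ, ψ` of the finite group `Γ`
one has `dim Hom_Γ(χ, ψ) = |Γ|⁻¹ ∑_γ χ(γ⁻¹) ψ(γ)`. -/
def ellipticPairing (π : Γ →* (V ≃ₗ[ℝ] V)) (f g : Γ → ℂ) : ℂ :=
  ∑ i ∈ Finset.range (Module.finrank ℝ V + 1),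
    (-1) ^ i * average Γ (fun γ => extChar π i γ⁻¹ * f γ⁻¹ * g γ)

lemma ellipticPairing_add (π : Γ →* (V ≃ₗ[ℝ] V)) (f f' g : Γ → ℂ) :
    ellipticPairing π (f + f') g = ellipticPairing π f g + ellipticPairing π f' g := by
  simp only [ellipticPairing, ← Finset.sum_add_distrib, ← mul_add, ← map_add]
  refine Finset.sum_congr rfl fun i _ => ?_
  congr 2
  funext γ
  simp only [Pi.add_apply]
  ring

lemma ellipticPairing_smul (π : Γ →* (V ≃ₗ[ℝ] V)) (c : ℂ) (f g : Γ → ℂ) :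
    ellipticPairing π (c • f) g = c * ellipticPairing π f g := by
  simp only [ellipticPairing, Finset.mul_sum]
  refine Finset.sum_congr rfl fun i _ => ?_
  rw [mul_left_comm, ← smul_eq_mul c (average Γ _), ← map_smul]
  congr 2
  funext γ
  simp only [Pi.smul_apply, smul_eq_mul]
  ring

/-- The radical of the elliptic pairing on `R(Γ)`. -/
def ellipticRadical (π : Γ →* (V ≃ₗ[ℝ] V)) : Submodule ℂ (repSpace Γ) where
  carrier := {f | ∀ g : repSpace Γ, ellipticPairing π f g = 0}
  zero_mem' g := by
    have := ellipticPairing_smul π 0 (0 : Γ → ℂ) g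
    simpa using this
  add_mem' {f f'} hf hf' g := by
    rw [Submodule.coe_add, ellipticPairing_add, hf g, hf' g, add_zero]
  smul_mem' c f hf g := by
    rw [Submodule.coe_smul, ellipticPairing_smul, hf g, mul_zero]

end Elliptic

/-! ### The Clifford algebra, the Pin group and the spin cover of the Weyl group -/

section Pin

variable (V : Type*) [NormedAddCommGroup V] [InnerProductSpace ℝ V]

/-- The quadratic form `v ↦ -⟨v, v⟩`. -/
abbrev negForm : QuadraticForm ℝ V := -(LinearMap.BilinMap.toQuadraticMap (innerₗ V))

/-- The Clifford algebra `C(V)`, generated by `V` with the relations `v² = -⟨v, v⟩`. -/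
abbrev Cl : Type _ := CliffordAlgebra (negForm V)

variable {V}

/-- The inclusion `V → C(V)`. -/
abbrev inc : V →ₗ[ℝ] Cl V := CliffordAlgebra.ι (negForm V)

lemma negForm_apply (v : V) : negForm V v = -inner ℝ v v := by
  simp [negForm]

lemma inc_injective : Function.Injective (inc : V →ₗ[ℝ] Cl V) := by
  refine (injective_iff_map_eq_zero _).2 fun v hv => ?_
  have : Invertible (2 : ℝ) := invertibleOfNonzero two_ne_zero
  have h : algebraMap ℝ (Cl V) (negForm V v) = 0 := by
    rw [← CliffordAlgebra.ι_sq_scalar, hv, zero_mul]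
  rw [map_eq_zero_iff _ (algebraMap ℝ (Cl V)).injective, negForm_apply, neg_eq_zero] at h
  exact inner_self_eq_zero.1 h

/-- `ε(a) V a⁻¹ ⊆ V`, where `ε` is the parity automorphism. -/
def PreservesV (a : (Cl V)ˣ) : Prop :=
  ∀ v : V, ∃ u : V, CliffordAlgebra.involute (a : Cl V) * inc v * (↑a⁻¹ : Cl V) = inc u

lemma PreservesV.exists_equiv [FiniteDimensional ℝ V] {a : (Cl V)ˣ} (ha : PreservesV a) :
    ∃ g : V ≃ₗ[ℝ] V, ∀ v : V,
      CliffordAlgebra.involute (a : Cl V) * inc v * (↑a⁻¹ : Cl V) = inc (g v) := by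
  choose u hu using ha
  let T : V →ₗ[ℝ] V :=
    { toFun := u
      map_add' := fun x y => inc_injective (by
        rw [← hu, map_add, map_add, ← hu, ← hu, mul_add, add_mul])
      map_smul' := fun c x => inc_injective (by
        rw [← hu, map_smul, RingHom.id_apply, map_smul, ← hu, mul_smul_comm, smul_mul_assoc]) }
  have hT : Function.Injective T := by
    intro x y hxy
    have h : inc (u x) = inc (u y) := congrArg inc hxy
    rw [← hu, ← hu, Units.mul_left_inj] at h
    have h2 : CliffordAlgebra.involute (↑a⁻¹ : Cl V) * CliffordAlgebra.involute (a : Cl V) = 1 := by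
      rw [← map_mul, Units.inv_mul, map_one]
    have h3 := congrArg (fun t => CliffordAlgebra.involute (↑a⁻¹ : Cl V) * t) h
    simp only [← mul_assoc, h2, one_mul] at h3
    exact inc_injective h3
  exact ⟨LinearEquiv.ofInjectiveEndo T hT, fun v => hu v⟩

lemma mul_inc_eq {a b : (Cl V)ˣ} {g h : V ≃ₗ[ℝ] V}
    (hg : ∀ v : V, CliffordAlgebra.involute (a : Cl V) * inc v * (↑a⁻¹ : Cl V) = inc (g v))
    (hh : ∀ v : V, CliffordAlgebra.involute (b : Cl V) * inc v * (↑b⁻¹ : Cl V) = inc (h v))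
    (v : V) :
    CliffordAlgebra.involute ((a * b : (Cl V)ˣ) : Cl V) * inc v * (↑(a * b)⁻¹ : Cl V)
      = inc ((g * h) v) := by
  rw [LinearEquiv.mul_apply, ← hg, ← hh, mul_inv_rev, Units.val_mul, Units.val_mul, map_mul]
  simp only [mul_assoc]

variable (V)
variable [FiniteDimensional ℝ V]

/-- `Pin(V) = {a ∈ C(V) : ε(a) V a⁻¹ ⊆ V, aᵗ = a⁻¹}`; here `star` is the anti-automorphism `a ↦ aᵗ`
of `C(V)` with `vᵗ = -v` for `v ∈ V`. -/
def Pin : Subgroup (Cl V)ˣ where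
  carrier := {a | PreservesV a ∧ star (a : Cl V) = (↑a⁻¹ : Cl V)}
  one_mem' := ⟨fun v => ⟨v, by simp⟩, by simp⟩
  mul_mem' {a b} ha hb := by
    refine ⟨fun v => ?_, ?_⟩
    · obtain ⟨u, hu⟩ := hb.1 v
      obtain ⟨w, hw⟩ := ha.1 u
      refine ⟨w, ?_⟩
      rw [← hw, ← hu, mul_inv_rev, Units.val_mul, Units.val_mul, map_mul]
      simp only [mul_assoc]
    · rw [mul_inv_rev, Units.val_mul, Units.val_mul, star_mul, ha.2, hb.2]
  inv_mem' {a} ha := by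
    refine ⟨fun v => ?_, ?_⟩
    · obtain ⟨g, hg⟩ := ha.1.exists_equiv
      refine ⟨g.symm v, ?_⟩
      have h := hg (g.symm v)
      rw [LinearEquiv.apply_symm_apply] at h
      have h2 : CliffordAlgebra.involute (↑a⁻¹ : Cl V) * CliffordAlgebra.involute (a : Cl V)
          = 1 := by
        rw [← map_mul, Units.inv_mul, map_one]
      rw [← h, inv_inv]
      simp only [← mul_assoc, h2, one_mul]
      simp only [mul_assoc, Units.inv_mul, mul_one]
    · rw [← ha.2, star_star, inv_inv]

variable {V}

/-- The projection `p : Pin(V) → GL(V)` (with image `O(V)`), `p(a)(v) = ε(a) v a⁻¹`. -/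
def pinProj : Pin V →* (V ≃ₗ[ℝ] V) :=
  MonoidHom.mk' (fun a => a.2.1.exists_equiv.choose) fun a b => by
    ext v
    apply inc_injective
    rw [← (a * b).2.1.exists_equiv.choose_spec v]
    exact mul_inc_eq a.2.1.exists_equiv.choose_spec b.2.1.exists_equiv.choose_spec v

lemma pinProj_spec (a : Pin V) (v : V) :
    CliffordAlgebra.involute ((a : (Cl V)ˣ) : Cl V) * inc v * (↑(a : (Cl V)ˣ)⁻¹ : Cl V)
      = inc (pinProj a v) :=
  a.2.1.exists_equiv.choose_spec v

variable (V) in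
/-- The element `-1` of `Pin(V)`. -/
def pinNegOne : Pin V :=
  ⟨-1, fun v => ⟨v, by simp⟩, by simp⟩

lemma pinProj_pinNegOne : pinProj (pinNegOne V) = 1 := by
  ext v
  apply inc_injective
  rw [← pinProj_spec]
  simp [pinNegOne]

end Pin

section RootSystem

variable {ι V N : Type*} [NormedAddCommGroup V] [InnerProductSpace ℝ V]
  [AddCommGroup N] [Module ℝ N]

/-- The Weyl group, as the subgroup of `GL(V)` generated by the reflections. -/
def weyl (P : RootPairing ι ℝ V N) : Subgroup (V ≃ₗ[ℝ] V) :=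
  Subgroup.closure (Set.range P.reflection)

variable [FiniteDimensional ℝ V]

/-- The spin cover `W̃ = p⁻¹(W) ⊆ Pin(V)`. -/
def spinCover (P : RootPairing ι ℝ V N) : Subgroup (Pin V) :=
  (weyl P).comap pinProj

/-- The projection `p : W̃ → W`. -/
def coverProj (P : RootPairing ι ℝ V N) : spinCover P →* weyl P :=
  (pinProj.comp (spinCover P).subtype).codRestrict (weyl P) fun a => a.2

/-- The reflection representation of `W` on `V`. -/
def weylAction (P : RootPairing ι ℝ V N) : weyl P →* (V ≃ₗ[ℝ] V) := (weyl P).subtype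

/-- The (nongenuine) action of `W̃` on `V`. -/
def coverAction (P : RootPairing ι ℝ V N) : spinCover P →* (V ≃ₗ[ℝ] V) :=
  (weylAction P).comp (coverProj P)

/-- The central element `z = -1` of `W̃`. -/
def coverZ (P : RootPairing ι ℝ V N) : spinCover P :=
  ⟨pinNegOne V, by
    change pinProj (pinNegOne V) ∈ weyl P
    rw [pinProj_pinNegOne]; exact one_mem _⟩

/-- `R̄(W) = R(W) / R_ind(W)`. -/
abbrev RbarW (P : RootPairing ι ℝ V N) : Type _ := EllipticQuotient (weylAction P)

/-- `R̄(W̃)`: the quotient of `R(W̃)` by the radical of the elliptic pairing. -/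
abbrev RbarCover (P : RootPairing ι ℝ V N) : Type _ :=
  repSpace (spinCover P) ⧸ ellipticRadical (coverAction P)

/-- `R_gen(W̃)`: the subspace of `R(W̃)` spanned by the irreducible genuine representations,
i.e. those on which `z` acts by `-1`. -/
def genuineSpace (P : RootPairing ι ℝ V N) : Submodule ℂ (repSpace (spinCover P)) :=
  Submodule.span ℂ
    {f | ∃ (n : ℕ) (ρ : Representation ℂ (spinCover P) (Fin n → ℂ)),
      ρ.IsIrreducible ∧ ρ (coverZ P) = -1 ∧ (f : spinCover P → ℂ) = ρ.character}

/-- `R̄_gen(W̃)`: the image of `R_gen(W̃)` in `R̄(W̃)`. -/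
def RbarGen (P : RootPairing ι ℝ V N) : Submodule ℂ (RbarCover P) :=
  (genuineSpace P).map (ellipticRadical (coverAction P)).mkQ

/-- The root system (equivalently, its Weyl group) is of type `A_n` for some `n`: with respect to
some base, its Cartan matrix is the Cartan matrix of type `A_n`, up to relabelling. -/
def IsTypeA (P : RootPairing ι ℝ V N) [P.IsCrystallographic] : Prop :=
  ∃ (b : P.Base) (n : ℕ) (e : b.support ≃ Fin n),
    b.cartanMatrix.reindex e e = CartanMatrix.A n

end RootSystem

/-! ### Spin modules -/

section Spin

variable {V : Type*} [NormedAddCommGroup V] [InnerProductSpace ℝ V]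
  {S : Type*} [AddCommGroup S] [Module ℂ S]

/-- `(γ, S)` is a simple complex `C(V)`-module. -/
structure IsSpinModule (γ : Cl V →ₐ[ℝ] Module.End ℂ S) : Prop where
  nontrivial : Nontrivial S
  simple : ∀ U : Submodule ℂ S, (∀ (a : Cl V), ∀ s ∈ U, γ a s ∈ U) → U = ⊥ ∨ U = ⊤

variable {ι N : Type*} [AddCommGroup N] [Module ℝ N] [FiniteDimensional ℝ V]

/-- The restriction of a `C(V)`-module `S` to `W̃ ⊆ Pin(V) ⊆ C(V)ˣ`. -/
def spinRep (P : RootPairing ι ℝ V N) (γ : Cl V →ₐ[ℝ] Module.End ℂ S) :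
    Representation ℂ (spinCover P) S :=
  ((γ : Cl V →* Module.End ℂ S).comp (Units.coeHom (Cl V))).comp
    ((Pin V).subtype.comp (spinCover P).subtype)

lemma character_mem_repSpace {Γ : Type*} [Group Γ] {M : Type*} [AddCommGroup M] [Module ℂ M]
    [FiniteDimensional ℂ M] (ρ : Representation ℂ Γ M) :
    ρ.character ∈ repSpace Γ := by
  let e : M ≃ₗ[ℂ] (Fin (Module.finrank ℂ M) → ℂ) := (Module.finBasis ℂ M).equivFun
  refine Submodule.subset_span ⟨Module.finrank ℂ M,
    (e.conjAlgEquiv ℂ : Module.End ℂ M →* _).comp ρ, ?_⟩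
  funext g
  exact (LinearMap.trace_conj' (ρ g) e).symm

variable [FiniteDimensional ℂ S]

/-- Tensoring with `S`: pull a virtual character of `W` back to `W̃` and multiply it by the
character of `S`. -/
def tensorFun (P : RootPairing ι ℝ V N) (γ : Cl V →ₐ[ℝ] Module.End ℂ S) :
    (weyl P → ℂ) →ₗ[ℂ] (spinCover P → ℂ) :=
  LinearMap.mulRight ℂ (spinRep P γ).character ∘ₗ LinearMap.funLeft ℂ ℂ (coverProj P)

lemma tensorFun_character (P : RootPairing ι ℝ V N) (γ : Cl V →ₐ[ℝ] Module.End ℂ S)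
    {M : Type*} [AddCommGroup M] [Module ℂ M] [FiniteDimensional ℂ M]
    (σ : Representation ℂ (weyl P) M) :
    tensorFun P γ σ.character =
      (Representation.tprod (σ.comp (coverProj P)) (spinRep P γ)).character := by
  rw [Representation.char_tensor]
  rfl

lemma tensorFun_mem (P : RootPairing ι ℝ V N) (γ : Cl V →ₐ[ℝ] Module.End ℂ S)
    (f : weyl P → ℂ) (hf : f ∈ repSpace (weyl P)) :
    tensorFun P γ f ∈ repSpace (spinCover P) := by
  have h : repSpace (weyl P) ≤ (repSpace (spinCover P)).comap (tensorFun P γ) := by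
    refine Submodule.span_le.2 ?_
    rintro _ ⟨n, σ, rfl⟩
    change tensorFun P γ σ.character ∈ repSpace (spinCover P)
    rw [tensorFun_character]
    exact character_mem_repSpace _
  exact h hf

/-- The linear map `R(W) → R(W̃)`, `σ ↦ σ ⊗ S`. -/
def tensorS (P : RootPairing ι ℝ V N) (γ : Cl V →ₐ[ℝ] Module.End ℂ S) :
    repSpace (weyl P) →ₗ[ℂ] repSpace (spinCover P) :=
  (tensorFun P γ).restrict (tensorFun_mem P γ)

end Spin

end SpinWeyl

end

/-!
Call an element of `W`, or of its spin cover `W̃`, elliptic if it fixes no nonzero vector of `V`.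
Virtual characters of a finite group are its class functions, and both quotients only see the values
on elliptic elements:

* `R_ind` consists of the class functions vanishing on elliptic elements (`mem_inducedSpace_iff`).
  A class function is a combination of functions induced from indicators on cyclic groups `⟨γ⟩`, and
  `V^⟨γ⟩ ≠ 0` exactly if `γ` is not elliptic.
* The elliptic pairing is `|Γ|⁻¹ ∑ det (1 - γ⁻¹) f(γ⁻¹) g(γ)`, so its radical has the same
  description (`mem_ellipticRadical_iff`).

Genuine class functions on `W̃` and the character `χ` of `S` both change sign under
multiplication by `z`. Hence multiplication by `χ` is a bijection between functions on elliptic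
elements if `χ` has no elliptic zero (`bijective_tensorBar`), and fails to be injective otherwise
(`character_ne_zero_of_injective_tensorBar`). The theorem reduces to finding the elliptic zeros of
`χ`.

Let `g ∈ W̃` lie over `w ∈ W`. If `g` is even and `-1` is not an eigenvalue of `w`, then
`χ(g) ≠ 0` (`trace_ne_zero_of_even`): otherwise the trace of `g x` would vanish for every even `x`.
If `g` is even and `w θ = -θ` with `θ ≠ 0`, then `g` anticommutes with `θ` and `χ(g) = 0`
(`trace_eq_zero_of_anticommute`). An elliptic `w` has determinant `(-1)^n`, where `n = dim V`. So
for even `n` the elliptic zeros lie over the elliptic `w` with eigenvalue `-1`. For odd `n`, `g` is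
odd; multiplying by the volume element, which is central and acts on `S` by a nonzero scalar, turns
it into an even element over `-w`, and `-w` does not have eigenvalue `-1`. There are no elliptic
zeros in this case (`character_ne_zero_of_odd`).

Now let `n` be even. In type `A_n`, an elliptic element permutes the `n + 1` coordinates without
nonconstant invariants, and the entries of an eigenvector for `-1` would be `n + 1` numbers of equal
absolute value with sum zero; this is impossible because `n + 1` is odd (`eq_zero_of_isTypeA`).
For an irreducible root system of another type, let `θ` be the highest root. If only one simple root
is not orthogonal to `θ`, the product of the reflections in `θ` and in the other simple roots is
elliptic and negates `θ`. Otherwise two simple roots `i ≠ j` pair positively with `θ` and have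
coefficient `1` in it; dominance of `θ` then forces the Dynkin diagram to be a simply laced path
from `i` to `j`, which is type `A` (`exists_reindex_eq_cartanMatrix_A`,
`exists_elliptic_of_not_isTypeA`).
-/

open scoped TensorProduct

noncomputable section

namespace SpinWeyl

/-! ### Virtual characters of a finite group are its class functions -/

section ClassFunctions

variable {Γ : Type*} [Group Γ]

lemma repSpace_conj {f : Γ → ℂ} (hf : f ∈ repSpace Γ) (x y : Γ) : f (x * y * x⁻¹) = f y := by
  have h : repSpace Γ ≤ LinearMap.ker (LinearMap.proj (R := ℂ) (φ := fun _ : Γ => ℂ) (x * y * x⁻¹)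
      - LinearMap.proj y) := by
    refine Submodule.span_le.2 ?_
    rintro _ ⟨n, ρ, rfl⟩
    simp only [SetLike.mem_coe, LinearMap.mem_ker, LinearMap.sub_apply, LinearMap.proj_apply]
    rw [Representation.char_conj, sub_self]
  simpa [sub_eq_zero] using h hf

lemma average_apply {Γ : Type*} [Fintype Γ] (f : Γ → ℂ) :
    average Γ f = (Nat.card Γ : ℂ)⁻¹ * ∑ γ : Γ, f γ := by
  classical
  unfold average
  rw [dif_pos (inferInstance : Finite Γ), Subsingleton.elim (Fintype.ofFinite Γ) ‹Fintype Γ›]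
  simp

lemma extendZero_apply_of_mem (L : Subgroup Γ) (f : L → ℂ) {γ : Γ} (h : γ ∈ L) :
    extendZero L f γ = f ⟨γ, h⟩ := by
  simp [extendZero, h]

lemma extendZero_apply_of_notMem (L : Subgroup Γ) (f : L → ℂ) {γ : Γ} (h : γ ∉ L) :
    extendZero L f γ = 0 := by
  simp [extendZero, h]

lemma induction_apply [Fintype Γ] (L : Subgroup Γ) (f : L → ℂ) (γ : Γ) :
    induction L f γ = (Nat.card L : ℂ)⁻¹ * ∑ x : Γ, extendZero L f (x⁻¹ * γ * x) := by
  have hL : (Nat.card L : ℂ) ≠ 0 := by exact_mod_cast Nat.card_pos.ne'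
  have hΓ : (Nat.card Γ : ℂ) ≠ 0 := by exact_mod_cast Nat.card_pos.ne'
  have hi : (L.index : ℂ) * Nat.card L = Nat.card Γ := by exact_mod_cast L.index_mul_card
  have : induction L f γ
      = (L.index : ℂ) * average Γ (fun x => extendZero L f (x⁻¹ * γ * x)) := rfl
  rw [this, average_apply, ← mul_assoc]
  congr 1
  rw [← hi] at hΓ ⊢
  have := left_ne_zero_of_mul hΓ
  field_simp

/-- If `p` is an idempotent commuting with a representation `ρ`, then `γ ↦ tr (ρ(γ) p)` is the
character of the subrepresentation on the range of `p`. -/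
lemma trace_mul_idempotent_mem_repSpace {M : Type*} [AddCommGroup M] [Module ℂ M]
    [FiniteDimensional ℂ M] (ρ : Representation ℂ Γ M) (p : Module.End ℂ M) (hp : p * p = p)
    (hc : ∀ γ, ρ γ * p = p * ρ γ) :
    (fun γ => LinearMap.trace ℂ M (ρ γ * p)) ∈ repSpace Γ := by
  have hst : ∀ γ, ∀ x ∈ LinearMap.range p, ρ γ x ∈ LinearMap.range p := by
    rintro γ _ ⟨y, rfl⟩
    exact ⟨ρ γ y, (LinearMap.congr_fun (hc γ) y).symm⟩
  let σ : Subrepresentation ρ := ⟨LinearMap.range p, fun γ v hv => hst γ v hv⟩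
  have h : ∀ γ, LinearMap.trace ℂ M (ρ γ * p) = σ.toRepresentation.character γ := by
    intro γ
    have h1 : ∀ x, (ρ γ * p) x ∈ LinearMap.range p := fun x => hst γ _ ⟨x, rfl⟩
    rw [← LinearMap.trace_restrict_eq_of_forall_mem _ _ h1]
    refine congrArg _ ?_
    ext ⟨_, y, rfl⟩
    change ρ γ (p (p y)) = ρ γ (p y)
    rw [← Module.End.mul_apply p p, hp]
  rw [show (fun γ => LinearMap.trace ℂ M (ρ γ * p)) = σ.toRepresentation.character from funext h]
  exact character_mem_repSpace _

/-- The trace of `φ ↦ φ ∘ s` on functions is the number of fixed points of `s`. -/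
lemma trace_funLeft {X : Type*} [Fintype X] [DecidableEq X] (s : X → X) :
    LinearMap.trace ℂ (X → ℂ) (LinearMap.funLeft ℂ ℂ s) = ∑ x, if s x = x then (1 : ℂ) else 0 := by
  rw [LinearMap.trace_eq_matrix_trace ℂ (Pi.basisFun ℂ X)]
  simp only [Matrix.trace, Matrix.diag, LinearMap.toMatrix_apply, Pi.basisFun_apply,
    Pi.basisFun_repr, LinearMap.funLeft_apply, Pi.single_apply]

/-- Right translation on the functions on a group. -/
def rightTranslation (Γ : Type*) [Group Γ] : Representation ℂ Γ (Γ → ℂ) where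
  toFun γ := LinearMap.funLeft ℂ ℂ (fun x => x * γ)
  map_one' := by ext; simp [LinearMap.funLeft_apply]
  map_mul' a b := by
    refine LinearMap.ext fun φ => funext fun x => ?_
    simp [LinearMap.funLeft_apply, mul_assoc]

/-- The character induced from a linear character `χ` of a subgroup is a character: it belongs to
the right translation action on the functions `φ` with `φ(lx) = χ(l) φ(x)`. -/
lemma induction_linearChar_mem_repSpace [Finite Γ] (L : Subgroup Γ) (χ : L →* ℂˣ) :
    induction L (fun l => (χ l : ℂ)) ∈ repSpace Γ := by
  classical
  let := Fintype.ofFinite Γ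
  have hL : (Nat.card L : ℂ) ≠ 0 := by exact_mod_cast Nat.card_pos.ne'
  let p : Module.End ℂ (Γ → ℂ) := (Nat.card L : ℂ)⁻¹ •
    ∑ l : L, ((χ l⁻¹ : ℂˣ) : ℂ) • LinearMap.funLeft ℂ ℂ (fun x : Γ => (l : Γ) * x)
  have hpa : ∀ (φ : Γ → ℂ) (x : Γ), p φ x
      = (Nat.card L : ℂ)⁻¹ * ∑ l : L, ((χ l⁻¹ : ℂˣ) : ℂ) * φ ((l : Γ) * x) := by
    intro φ x
    simp [p, LinearMap.funLeft_apply, LinearMap.sum_apply, Finset.sum_apply]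
  have hpl : ∀ (φ : Γ → ℂ) (l : L) (x : Γ), p φ (l * x) = χ l * p φ x := by
    intro φ l x
    rw [hpa, hpa, mul_left_comm, Finset.mul_sum _ _ (χ l : ℂ)]
    congr 1
    refine Fintype.sum_equiv (Equiv.mulRight l) _ _ fun k => ?_
    simp only [Equiv.coe_mulRight, mul_inv_rev, map_mul, Units.val_mul, Subgroup.coe_mul, mul_assoc]
    rw [← mul_assoc (χ l : ℂ), ← Units.val_mul, ← map_mul, mul_inv_cancel, map_one, Units.val_one,
      one_mul]
  have hpp : p * p = p := by
    refine LinearMap.ext fun φ => funext fun x => ?_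
    rw [Module.End.mul_apply, hpa]
    simp only [hpl]
    have h : ∀ l : L, ((χ l⁻¹ : ℂˣ) : ℂ) * (χ l * p φ x) = p φ x := fun l => by
      rw [← mul_assoc, ← Units.val_mul, ← map_mul, inv_mul_cancel, map_one, Units.val_one, one_mul]
    simp only [h]
    rw [Finset.sum_const, Finset.card_univ, nsmul_eq_mul, ← mul_assoc, ← Nat.card_eq_fintype_card,
      inv_mul_cancel₀ hL, one_mul]
  have hc : ∀ γ, rightTranslation Γ γ * p = p * rightTranslation Γ γ := by
    intro γ
    refine LinearMap.ext fun φ => funext fun x => ?_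
    change p φ (x * γ) = p (fun x => φ (x * γ)) x
    simp only [hpa, mul_assoc]
  convert trace_mul_idempotent_mem_repSpace (rightTranslation Γ) p hpp hc using 1
  funext γ
  have hs : rightTranslation Γ γ * p = (Nat.card L : ℂ)⁻¹ •
      ∑ l : L, ((χ l⁻¹ : ℂˣ) : ℂ) • LinearMap.funLeft ℂ ℂ (fun x : Γ => (l : Γ) * x * γ) := by
    refine LinearMap.ext fun φ => funext fun x => ?_
    change p φ (x * γ) = _
    simp [hpa, LinearMap.funLeft_apply, LinearMap.sum_apply, Finset.sum_apply, mul_assoc]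
  rw [induction_apply, hs, map_smul, map_sum, smul_eq_mul]
  congr 1
  simp only [map_smul, trace_funLeft, smul_eq_mul, Finset.mul_sum, mul_ite, mul_one, mul_zero]
  rw [Finset.sum_comm]
  refine Fintype.sum_equiv (Equiv.inv Γ) _ _ fun x => ?_
  simp only [Equiv.inv_apply]
  -- only `l = x⁻¹ γ⁻¹ x` contributes
  by_cases h : x⁻¹ * γ * x ∈ L
  · rw [extendZero_apply_of_mem L _ h, Finset.sum_eq_single (⟨x⁻¹ * γ * x, h⟩⁻¹ : L)]
    · rw [if_pos (by simp [mul_assoc]), inv_inv]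
    · intro l _ hl
      refine if_neg fun h2 => hl ?_
      ext
      simp only [InvMemClass.coe_inv]
      rw [eq_inv_iff_mul_eq_one]
      have : (l : Γ) * (x⁻¹ * γ * x) = (l * x⁻¹ * γ) * x := by group
      rw [this, h2, inv_mul_cancel]
    · simp
  · rw [extendZero_apply_of_notMem L _ h]
    refine (Finset.sum_eq_zero fun l _ => if_neg fun h2 => h ?_).symm
    have : x⁻¹ * γ * x = ((l⁻¹ : L) : Γ) := by
      rw [InvMemClass.coe_inv, eq_inv_iff_mul_eq_one, mul_eq_one_iff_eq_inv, eq_comm,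
        inv_eq_iff_mul_eq_one]
      have : (l : Γ) * (x⁻¹ * γ * x) = (l * x⁻¹ * γ) * x := by group
      rw [this, h2, inv_mul_cancel]
    rw [this]
    exact SetLike.coe_mem _

/-- Every function on a finite commutative group is a combination of linear characters. -/
lemma span_linearChar_eq_top {L : Type*} [Group L] [Finite L] (hcomm : ∀ a b : L, a * b = b * a) :
    Submodule.span ℂ (Set.range fun χ : L →* ℂˣ => fun l => (χ l : ℂ)) = ⊤ := by
  let : CommGroup L := { ‹Group L› with mul_comm := hcomm }
  rw [eq_top_iff]
  have h := (AddChar.complexBasis (Additive L)).span_eq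
  rw [AddChar.coe_complexBasis] at h
  intro f _
  have hf : (f : Additive L → ℂ) ∈ (⊤ : Submodule ℂ (Additive L → ℂ)) := trivial
  rw [← h] at hf
  refine Submodule.span_mono ?_ hf
  rintro _ ⟨ψ, rfl⟩
  exact ⟨(AddChar.toMonoidHomEquiv ψ).toHomUnits, rfl⟩

lemma repSpace_eq_top {L : Type*} [Group L] [Finite L] (hcomm : ∀ a b : L, a * b = b * a) :
    repSpace L = ⊤ := by
  rw [eq_top_iff, ← span_linearChar_eq_top hcomm, Submodule.span_le]
  rintro _ ⟨χ, rfl⟩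
  let ρ : Representation ℂ L ℂ :=
    { toFun := fun l => (χ l : ℂ) • 1
      map_one' := by simp
      map_mul' := fun a b => by ext; simp [mul_comm] }
  have h : (fun l => (χ l : ℂ)) = ρ.character := by
    funext l
    simp [Representation.character, ρ]
  change (fun l => (χ l : ℂ)) ∈ repSpace L
  rw [h]
  exact character_mem_repSpace ρ

lemma zpowers_mul_comm (γ : Γ) (a b : Subgroup.zpowers γ) : a * b = b * a := by
  obtain ⟨_, i, rfl⟩ := a
  obtain ⟨_, j, rfl⟩ := b
  ext
  simp [← zpow_add, add_comm]

/-- The function induced from the indicator of `γ` on the cyclic group generated by `γ`; it is a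
multiple of the indicator of the conjugacy class of `γ`. -/
def classInd (γ : Γ) : Γ → ℂ :=
  induction (Subgroup.zpowers γ) (by
    classical exact Pi.single ⟨γ, Subgroup.mem_zpowers γ⟩ 1)

lemma classInd_mem_repSpace [Finite Γ] (γ : Γ) : classInd γ ∈ repSpace Γ := by
  have h : (⊤ : Submodule ℂ (Subgroup.zpowers γ → ℂ)) ≤
      (repSpace Γ).comap (induction (Subgroup.zpowers γ)) := by
    rw [← span_linearChar_eq_top (zpowers_mul_comm γ), Submodule.span_le]
    rintro _ ⟨χ, rfl⟩
    exact induction_linearChar_mem_repSpace _ χ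
  exact h Submodule.mem_top

lemma classInd_mem_inducedSpace [Finite Γ] {V : Type*} [AddCommGroup V] [Module ℝ V]
    (π : Γ →* (V ≃ₗ[ℝ] V)) {γ : Γ} {v : V} (hv : v ≠ 0) (hγ : π γ v = v) :
    classInd γ ∈ inducedSpace π := by
  refine Submodule.mem_iSup_of_mem (Subgroup.zpowers γ) (Submodule.mem_iSup_of_mem ⟨v, hv, ?_⟩ ?_)
  · have h : Subgroup.zpowers γ ≤
        (MulAction.stabilizer (V ≃ₗ[ℝ] V) v).comap π := by
      rw [Subgroup.zpowers_le]
      exact hγ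
    exact fun l hl => h hl
  · refine Submodule.mem_map_of_mem ?_
    rw [repSpace_eq_top (zpowers_mul_comm γ)]
    trivial

lemma eq_sum_classInd [Fintype Γ] {f : Γ → ℂ} (hf : ∀ x y, f (x * y * x⁻¹) = f y) :
    f = ∑ γ, (f γ * (Nat.card (Subgroup.zpowers γ) / Nat.card Γ)) • classInd γ := by
  classical
  funext y
  have hΓ : (Nat.card Γ : ℂ) ≠ 0 := by exact_mod_cast Nat.card_pos.ne'
  have h : ∀ γ, (f γ * (Nat.card (Subgroup.zpowers γ) / Nat.card Γ)) * classInd γ y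
      = (Nat.card Γ : ℂ)⁻¹ * ∑ x : Γ, if x⁻¹ * y * x = γ then f γ else 0 := by
    intro γ
    have hL : (Nat.card (Subgroup.zpowers γ) : ℂ) ≠ 0 := by exact_mod_cast Nat.card_pos.ne'
    have hc : ∀ x, extendZero (Subgroup.zpowers γ)
        (Pi.single ⟨γ, Subgroup.mem_zpowers γ⟩ 1) (x⁻¹ * y * x)
        = if x⁻¹ * y * x = γ then (1 : ℂ) else 0 := by
      intro x
      by_cases h : x⁻¹ * y * x ∈ Subgroup.zpowers γ
      · rw [extendZero_apply_of_mem _ _ h, Pi.single_apply]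
        simp [Subtype.ext_iff]
      · rw [extendZero_apply_of_notMem _ _ h, if_neg]
        rintro h2
        exact h (h2 ▸ Subgroup.mem_zpowers γ)
    have hi : classInd γ y = (Nat.card (Subgroup.zpowers γ) : ℂ)⁻¹ *
        ∑ x : Γ, if x⁻¹ * y * x = γ then (1 : ℂ) else 0 := by
      rw [Finset.sum_congr rfl fun x _ => (hc x).symm, ← induction_apply]
      unfold classInd
      congr!
    rw [hi, Finset.mul_sum, Finset.mul_sum, Finset.mul_sum]
    refine Finset.sum_congr rfl fun x _ => ?_
    split_ifs
    · field_simp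
    · simp
  simp only [Finset.sum_apply, Pi.smul_apply, smul_eq_mul, h]
  rw [← Finset.mul_sum, Finset.sum_comm]
  have h2 : ∀ x : Γ, f (x⁻¹ * y * x) = f y := fun x => by simpa using hf x⁻¹ y
  simp [h2]

/-- The span of the characters of a finite group is the space of class functions. -/
lemma mem_repSpace_iff [Finite Γ] {f : Γ → ℂ} :
    f ∈ repSpace Γ ↔ ∀ x y, f (x * y * x⁻¹) = f y := by
  refine ⟨repSpace_conj, fun hf => ?_⟩
  let := Fintype.ofFinite Γ
  rw [eq_sum_classInd hf]
  exact Submodule.sum_mem _ fun γ _ => Submodule.smul_mem _ _ (classInd_mem_repSpace γ)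

/-- `γ` is elliptic if it fixes no nonzero vector of `V`. -/
def IsElliptic {V : Type*} [AddCommGroup V] [Module ℝ V] (π : Γ →* (V ≃ₗ[ℝ] V)) (γ : Γ) : Prop :=
  ∀ v : V, π γ v = v → v = 0

/-- `R_ind(Γ)` consists of the class functions that vanish on the elliptic elements. -/
lemma mem_inducedSpace_iff [Finite Γ] {V : Type*} [AddCommGroup V] [Module ℝ V]
    (π : Γ →* (V ≃ₗ[ℝ] V)) {f : Γ → ℂ} (hf : f ∈ repSpace Γ) :
    f ∈ inducedSpace π ↔ ∀ γ, IsElliptic π γ → f γ = 0 := by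
  let := Fintype.ofFinite Γ
  constructor
  · intro h γ hγ
    have hle : inducedSpace π
        ≤ LinearMap.ker (LinearMap.proj (R := ℂ) (φ := fun _ : Γ => ℂ) γ) := by
      refine iSup₂_le ?_
      rintro L ⟨v, hv, hL⟩ _ ⟨f, -, rfl⟩
      rw [LinearMap.mem_ker, LinearMap.proj_apply, induction_apply]
      convert mul_zero _
      refine Finset.sum_eq_zero fun x _ => extendZero_apply_of_notMem _ _ fun hx => hv ?_
      have h1 := hL _ hx
      rw [map_mul, map_mul, map_inv, LinearEquiv.mul_apply, LinearEquiv.mul_apply] at h1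
      have h2 : π γ (π x v) = π x v := by
        have := congrArg (π x) h1
        rwa [← LinearEquiv.mul_apply (π x) (π x)⁻¹, mul_inv_cancel, LinearEquiv.coe_one, id] at this
      have h3 := hγ _ h2
      rwa [LinearEquiv.map_eq_zero_iff] at h3
    exact hle h
  · intro h
    rw [eq_sum_classInd (repSpace_conj hf)]
    refine Submodule.sum_mem _ fun γ _ => ?_
    by_cases hγ : IsElliptic π γ
    · rw [h γ hγ, zero_mul, zero_smul]
      exact zero_mem _
    · unfold IsElliptic at hγ
      push Not at hγ
      obtain ⟨v, hv, hv0⟩ := hγ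
      exact Submodule.smul_mem _ _ (classInd_mem_inducedSpace π hv0 hv)

end ClassFunctions

/-! ### The elliptic pairing and its radical -/

section Pairing

/-- The trace on an exterior power is a sum of principal minors. -/
lemma trace_exteriorPower_map {R M : Type*} [CommRing R] [Nontrivial R] [AddCommGroup M]
    [Module R M] {n : ℕ} (b : Module.Basis (Fin n) R M) (A : M →ₗ[R] M) (k : ℕ) :
    LinearMap.trace R (⋀[R]^k M) (exteriorPower.map k A)
      = ∑ s ∈ Finset.univ.powersetCard k,
        ((LinearMap.toMatrix b b A).submatrix (Subtype.val : s → Fin n) Subtype.val).det := by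
  classical
  let : Fintype (Set.powersetCard (Fin n) k) := Fintype.ofFinite _
  rw [LinearMap.trace_eq_matrix_trace R (b.exteriorPower k), Matrix.trace,
    Finset.sum_subtype (p := fun s => s ∈ Set.powersetCard (Fin n) k)
      (Finset.univ.powersetCard k) (fun s => by
        simp [Finset.mem_powersetCard, Set.powersetCard.mem_iff])]
  refine Finset.sum_congr rfl fun s _ => ?_
  rw [Matrix.diag_apply, LinearMap.toMatrix_apply, exteriorPower.basis_apply,
    exteriorPower.map_apply_ιMulti_family, exteriorPower.basis_repr_apply,
    exteriorPower.ιMulti_family, exteriorPower.ιMultiDual_apply_ιMulti,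
    ← Matrix.det_transpose]
  rw [← Matrix.det_submatrix_equiv_self (s.1.orderIsoOfFin s.2).toEquiv]
  refine congrArg _ ?_
  ext i j
  simp only [Matrix.transpose_apply, Matrix.of_apply, Matrix.submatrix_apply,
    LinearMap.toMatrix_apply, Set.powersetCard.ofFinEmbEquiv_symm_apply, Function.comp_apply,
    Module.Basis.coord_apply]
  rfl

/-- The alternating sum of the exterior powers has character `det (1 - A)`. -/
lemma sum_trace_exteriorPower_map {K M : Type*} [Field K] [AddCommGroup M] [Module K M]
    [FiniteDimensional K M] (A : M →ₗ[K] M) :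
    ∑ i ∈ Finset.range (Module.finrank K M + 1),
      (-1) ^ i * LinearMap.trace K (⋀[K]^i M) (exteriorPower.map i A) = LinearMap.det (1 - A) := by
  set n := Module.finrank K M with hn
  let b : Module.Basis (Fin n) K M := Module.finBasis K M
  set B := LinearMap.toMatrix b b A with hB
  have h1 : LinearMap.det (1 - A) = B.charpoly.eval 1 := by
    rw [Matrix.eval_charpoly, ← LinearMap.det_toMatrix b, map_sub, ← hB, LinearMap.toMatrix_one,
      map_one]
  rw [h1, Polynomial.eval_eq_sum_range' (n := n + 1)
    (by rw [Matrix.charpoly_natDegree_eq_dim, Fintype.card_fin]; omega),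
    ← Finset.sum_range_reflect (fun i => B.charpoly.coeff i * 1 ^ i)]
  refine Finset.sum_congr rfl fun k hk => ?_
  rw [Finset.mem_range] at hk
  have h2 := Matrix.charpoly_coeff_eq_sum_minors B k (by rw [Fintype.card_fin]; omega)
  rw [Fintype.card_fin] at h2
  rw [one_pow, mul_one, show n + 1 - 1 - k = n - k by omega, h2, trace_exteriorPower_map b]

variable {Γ : Type*} [Group Γ] {V : Type*} [AddCommGroup V] [Module ℝ V]

lemma ellipticPairing_eq [Fintype Γ] [FiniteDimensional ℝ V] (π : Γ →* (V ≃ₗ[ℝ] V)) (f g : Γ → ℂ) :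
    ellipticPairing π f g = (Nat.card Γ : ℂ)⁻¹ * ∑ γ : Γ,
      ((LinearMap.det (1 - (π γ⁻¹ : V →ₗ[ℝ] V)) : ℝ) : ℂ) * f γ⁻¹ * g γ := by
  simp only [ellipticPairing, average_apply]
  simp only [← sum_trace_exteriorPower_map, extChar]
  simp only [Complex.ofReal_sum, Finset.mul_sum, Finset.sum_mul]
  rw [Finset.sum_comm]
  refine Finset.sum_congr rfl fun γ _ => Finset.sum_congr rfl fun i _ => ?_
  push_cast
  ring

lemma isElliptic_iff_det [FiniteDimensional ℝ V] (π : Γ →* (V ≃ₗ[ℝ] V)) (γ : Γ) :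
    IsElliptic π γ ↔ LinearMap.det (1 - (π γ : V →ₗ[ℝ] V)) ≠ 0 := by
  rw [← isUnit_iff_ne_zero, ← LinearMap.isUnit_iff_isUnit_det, LinearMap.isUnit_iff_ker_eq_bot,
    LinearMap.ker_eq_bot']
  refine forall_congr' fun v => ?_
  simp [sub_eq_zero, eq_comm (a := v)]

lemma isElliptic_conj {π : Γ →* (V ≃ₗ[ℝ] V)} {γ : Γ} (h : IsElliptic π γ) (x : Γ) :
    IsElliptic π (x * γ * x⁻¹) := by
  intro v hv
  have h1 : π γ (π x⁻¹ v) = π x⁻¹ v := by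
    have h2 := congrArg (π x⁻¹) hv
    rwa [← LinearEquiv.mul_apply, ← map_mul, mul_assoc, inv_mul_cancel_left, map_mul,
      LinearEquiv.mul_apply] at h2
  have h3 := h _ h1
  rwa [LinearEquiv.map_eq_zero_iff] at h3

/-- The radical of the elliptic pairing consists of the class functions that vanish on the elliptic
elements. -/
lemma mem_ellipticRadical_iff [Finite Γ] [FiniteDimensional ℝ V] (π : Γ →* (V ≃ₗ[ℝ] V))
    (f : repSpace Γ) :
    f ∈ ellipticRadical π ↔ ∀ γ, IsElliptic π γ → (f : Γ → ℂ) γ = 0 := by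
  let := Fintype.ofFinite Γ
  have hΓ : (Nat.card Γ : ℂ) ≠ 0 := by exact_mod_cast Nat.card_pos.ne'
  constructor
  · intro h
    -- pairing with the conjugate of `D` gives the sum of the `|D γ|²`
    let D : Γ → ℂ := fun γ => ((LinearMap.det (1 - (π γ⁻¹ : V →ₗ[ℝ] V)) : ℝ) : ℂ) * (f : Γ → ℂ) γ⁻¹
    have hD : (fun γ => starRingEnd ℂ (D γ)) ∈ repSpace Γ := by
      refine mem_repSpace_iff.2 fun x y => ?_
      have h1 : (x * y * x⁻¹)⁻¹ = x * y⁻¹ * x⁻¹ := by group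
      have h2 : LinearMap.det (1 - (π (x * y⁻¹ * x⁻¹) : V →ₗ[ℝ] V))
          = LinearMap.det (1 - (π y⁻¹ : V →ₗ[ℝ] V)) := by
        rw [← LinearMap.det_conj (1 - (π y⁻¹ : V →ₗ[ℝ] V)) (π x)]
        refine congrArg _ (LinearMap.ext fun v => ?_)
        have h3 : π x⁻¹ v = (π x).symm v := by rw [map_inv]; rfl
        change v - π (x * y⁻¹ * x⁻¹) v = π x ((π x).symm v - π y⁻¹ ((π x).symm v))
        rw [map_sub, LinearEquiv.apply_symm_apply, map_mul, map_mul, LinearEquiv.mul_apply,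
          LinearEquiv.mul_apply, h3]
      simp only [D, h1, h2, repSpace_conj f.2]
    have h0 := h ⟨_, hD⟩
    rw [ellipticPairing_eq, mul_eq_zero, or_iff_right (inv_ne_zero hΓ)] at h0
    change ∑ γ, D γ * starRingEnd ℂ (D γ) = 0 at h0
    have h1 : ∑ γ, Complex.normSq (D γ) = 0 := by
      have : ((∑ γ, Complex.normSq (D γ) : ℝ) : ℂ) = 0 := by
        rw [← h0, Complex.ofReal_sum]
        exact Finset.sum_congr rfl fun γ _ => (Complex.mul_conj _).symm
      exact_mod_cast this
    rw [Finset.sum_eq_zero_iff_of_nonneg fun γ _ => Complex.normSq_nonneg _] at h1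
    intro γ hγ
    have h2 := h1 γ⁻¹ (Finset.mem_univ _)
    rw [Complex.normSq_eq_zero, mul_eq_zero, inv_inv, Complex.ofReal_eq_zero] at h2
    exact h2.resolve_left ((isElliptic_iff_det π γ).1 hγ)
  · intro h g
    rw [ellipticPairing_eq]
    convert mul_zero _
    refine Finset.sum_eq_zero fun γ _ => ?_
    by_cases hγ : IsElliptic π γ⁻¹
    · rw [h _ hγ, mul_zero, zero_mul]
    · rw [isElliptic_iff_det, not_not] at hγ
      rw [hγ, Complex.ofReal_zero, zero_mul, zero_mul]

end Pairing

/-! ### Decomposition into irreducible characters -/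

section Irreducible

variable {Γ : Type*} [Group Γ]

/-- An intertwining equivalence transports subrepresentations. -/
def subrepresentationEquiv {M M' : Type*} [AddCommGroup M] [Module ℂ M] [AddCommGroup M']
    [Module ℂ M'] {ρ : Representation ℂ Γ M} {σ : Representation ℂ Γ M'} (e : M ≃ₗ[ℂ] M')
    (he : ∀ g v, σ g (e v) = e (ρ g v)) : Subrepresentation ρ ≃o Subrepresentation σ where
  toFun U := ⟨U.toSubmodule.comap (e.symm : M' →ₗ[ℂ] M), fun g v hv => by
    obtain ⟨w, rfl⟩ := e.surjective v
    rw [he]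
    simp only [Submodule.mem_comap, LinearEquiv.coe_coe, LinearEquiv.symm_apply_apply] at hv ⊢
    exact U.apply_mem_toSubmodule g hv⟩
  invFun U := ⟨U.toSubmodule.comap (e : M →ₗ[ℂ] M'), fun g v hv => by
    simp only [Submodule.mem_comap, LinearEquiv.coe_coe] at hv ⊢
    rw [← he]
    exact U.apply_mem_toSubmodule g hv⟩
  left_inv U := by
    refine Subrepresentation.toSubmodule_injective (Submodule.ext fun x => ?_)
    simp
  right_inv U := by
    refine Subrepresentation.toSubmodule_injective (Submodule.ext fun x => ?_)
    simp
  map_rel_iff' {U U'} := by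
    constructor
    · intro h x hx
      have : e x ∈ U.toSubmodule.comap (e.symm : M' →ₗ[ℂ] M) := by
        rw [Submodule.mem_comap, LinearEquiv.coe_coe, LinearEquiv.symm_apply_apply]
        exact hx
      have h2 : (e.symm (e x)) ∈ U'.toSubmodule := h this
      rwa [LinearEquiv.symm_apply_apply] at h2
    · intro h x hx
      exact h hx

/-- Complete reducibility: the character of a finite dimensional representation on which `z` acts
by `-1` is a combination of irreducible characters with the same property. -/
lemma character_mem_span_irreducible [Finite Γ] (z : Γ) {M : Type*} [AddCommGroup M] [Module ℂ M]
    [FiniteDimensional ℂ M] (ρ : Representation ℂ Γ M) (hz : ρ z = -1) :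
    ρ.character ∈ Submodule.span ℂ {f : Γ → ℂ | ∃ (n : ℕ) (σ : Representation ℂ Γ (Fin n → ℂ)),
      σ.IsIrreducible ∧ σ z = -1 ∧ f = σ.character} := by
  induction hd : Module.finrank ℂ M using Nat.strong_induction_on generalizing M with
  | _ d ih =>
  by_cases hirr : ρ.IsIrreducible
  · refine Submodule.subset_span ?_
    let e : M ≃ₗ[ℂ] (Fin (Module.finrank ℂ M) → ℂ) := (Module.finBasis ℂ M).equivFun
    let σ : Representation ℂ Γ (Fin (Module.finrank ℂ M) → ℂ) :=
      (e.conjAlgEquiv ℂ : Module.End ℂ M →* _).comp ρ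
    have hσ : ∀ g v, σ g v = e (ρ g (e.symm v)) := fun g v => rfl
    refine ⟨_, σ, ?_, ?_, ?_⟩
    · exact (subrepresentationEquiv e fun g v => by
        rw [hσ, LinearEquiv.symm_apply_apply]).isSimpleOrder_iff.1 hirr
    · refine LinearMap.ext fun v => ?_
      rw [hσ, hz]
      simp
    · funext g
      exact (LinearMap.trace_conj' (ρ g) e).symm
  · by_cases h0 : Module.finrank ℂ M = 0
    · have : ρ.character = 0 := by
        funext g
        have : Subsingleton M := Module.finrank_zero_iff.1 h0
        rw [Representation.character, Subsingleton.elim (ρ g) 0, map_zero]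
        rfl
      rw [this]
      exact zero_mem _
    have hM : Nontrivial M := Module.nontrivial_of_finrank_pos (Nat.pos_of_ne_zero h0)
    have hN : Nontrivial (Subrepresentation ρ) := by
      refine ⟨⊥, ⊤, fun h => ?_⟩
      exact bot_ne_top (α := Submodule ℂ M) (congrArg Subrepresentation.toSubmodule h)
    obtain ⟨U, hU0, hU1⟩ : ∃ U : Subrepresentation ρ, U ≠ ⊥ ∧ U ≠ ⊤ := by
      by_contra! hcon
      exact hirr ⟨fun U => or_iff_not_imp_left.2 (hcon U)⟩
    obtain ⟨U', hUU'⟩ := exists_isCompl U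
    have hc : IsCompl U.toSubmodule U'.toSubmodule := by
      refine ⟨disjoint_iff.2 ?_, codisjoint_iff.2 ?_⟩
      · exact congrArg Subrepresentation.toSubmodule hUU'.inf_eq_bot
      · exact congrArg Subrepresentation.toSubmodule hUU'.sup_eq_top
    have hchar : ρ.character = U.toRepresentation.character + U'.toRepresentation.character := by
      funext g
      let e := Submodule.prodEquivOfIsCompl _ _ hc
      have h1 : ρ g = e.conj ((U.toRepresentation g).prodMap (U'.toRepresentation g)) := by
        refine LinearMap.ext fun v => ?_
        obtain ⟨⟨x, y⟩, rfl⟩ := e.surjective v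
        simp only [LinearEquiv.conj_apply, LinearMap.comp_apply, LinearEquiv.coe_coe,
          LinearEquiv.symm_apply_apply, LinearMap.prodMap_apply]
        simp only [e, Submodule.coe_prodEquivOfIsCompl', map_add]
        rfl
      change LinearMap.trace ℂ M (ρ g) = _
      rw [h1, LinearMap.trace_conj', LinearMap.trace_prodMap']
      rfl
    have hsum := Submodule.finrank_add_eq_of_isCompl hc
    have hpos : ∀ W : Subrepresentation ρ, W ≠ ⊥ → 0 < Module.finrank ℂ W.toSubmodule := by
      intro W hW
      rw [Nat.pos_iff_ne_zero, Ne, Submodule.finrank_eq_zero]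
      exact fun h => hW (Subrepresentation.toSubmodule_injective h)
    have hU' : U' ≠ ⊥ := by
      rintro rfl
      exact hU1 (by simpa using hUU'.sup_eq_top)
    have hzr : ∀ W : Subrepresentation ρ, W.toRepresentation z = -1 := by
      intro W
      refine LinearMap.ext fun v => Subtype.ext ?_
      change ρ z v = _
      rw [hz]
      rfl
    rw [hchar]
    have hp := hpos U hU0
    have hp' := hpos U' hU'
    exact Submodule.add_mem _ (ih _ (by omega) _ (hzr U) rfl) (ih _ (by omega) _ (hzr U') rfl)

end Irreducible

/-! ### The kernel of the Pin group over the orthogonal group -/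

section Kernel

open CliffordAlgebra

/-- Euler's formula: on `⋀^k` the operator `∑ eᵢ ∧ (eᵢ^* ⌋ x)` is multiplication by `k`. -/
lemma sum_ι_mul_contractLeft {K M ι : Type*} [Field K] [AddCommGroup M] [Module K M] [Fintype ι]
    (b : Module.Basis ι K M) {k : ℕ} {x : ExteriorAlgebra K M} (hx : x ∈ ⋀[K]^k M) :
    ∑ i, ExteriorAlgebra.ι K (b i) * contractLeft (Q := (0 : QuadraticForm K M)) (b.coord i) x
      = (k : K) • x := by
  induction hx using Submodule.pow_induction_on_left' with
  | algebraMap r =>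
    simp only [Nat.cast_zero, zero_smul]
    refine Finset.sum_eq_zero fun i _ => ?_
    rw [contractLeft_algebraMap, mul_zero]
  | add x y i hx hy ihx ihy =>
    simp only [map_add, mul_add, Finset.sum_add_distrib, ihx, ihy, smul_add]
  | mem_mul m hm i x hx ih =>
    obtain ⟨u, rfl⟩ := hm
    have h : ∀ j, ExteriorAlgebra.ι K (b j) *
        contractLeft (Q := (0 : QuadraticForm K M)) (b.coord j) (ExteriorAlgebra.ι K u * x)
        = ExteriorAlgebra.ι K (b.coord j u • b j) * x +
          ExteriorAlgebra.ι K u * (ExteriorAlgebra.ι K (b j) *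
            contractLeft (Q := (0 : QuadraticForm K M)) (b.coord j) x) := by
      intro j
      have h1 := ExteriorAlgebra.ι_add_mul_swap (R := K) (b j) u
      rw [show contractLeft (Q := (0 : QuadraticForm K M)) (b.coord j) (ExteriorAlgebra.ι K u * x)
          = _ from contractLeft_ι_mul _ u x, mul_sub, ← mul_assoc,
        show ExteriorAlgebra.ι K (b j) * CliffordAlgebra.ι (0 : QuadraticForm K M) u
          = -(ExteriorAlgebra.ι K u * ExteriorAlgebra.ι K (b j)) from eq_neg_of_add_eq_zero_left h1,
        map_smul, mul_smul_comm, smul_mul_assoc, neg_mul, sub_neg_eq_add, mul_assoc]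
    simp only [h, Finset.sum_add_distrib, ← Finset.sum_mul, ← Finset.mul_sum, ih, ← map_sum]
    have h2 : ∑ j, b.coord j u • b j = u := b.sum_repr u
    rw [h2, mul_smul_comm]
    push_cast
    module

/-- An element of the exterior algebra killed by all contractions is a scalar. -/
lemma exists_algebraMap_of_contractLeft_eq_zero {K M : Type*} [Field K] [CharZero K]
    [AddCommGroup M] [Module K M] [FiniteDimensional K M] {x : ExteriorAlgebra K M}
    (hx : ∀ d : Module.Dual K M, contractLeft (Q := (0 : QuadraticForm K M)) d x = 0) :
    ∃ r : K, x = algebraMap K _ r := by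
  classical
  let b := Module.finBasis K M
  let E : ExteriorAlgebra K M →ₗ[K] ExteriorAlgebra K M := ∑ i,
    LinearMap.mulLeft K (ExteriorAlgebra.ι K (b i)) ∘ₗ
      contractLeft (Q := (0 : QuadraticForm K M)) (b.coord i)
  have hE : ∀ y, E y = ∑ i, ExteriorAlgebra.ι K (b i) *
      contractLeft (Q := (0 : QuadraticForm K M)) (b.coord i) y := by
    intro y
    simp [E, LinearMap.sum_apply]
  have hEx : E x = 0 := by
    rw [hE]
    exact Finset.sum_eq_zero fun i _ => by rw [hx, mul_zero]
  let c : ℕ → ExteriorAlgebra K M := fun k =>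
    (DirectSum.decompose (fun i : ℕ => ⋀[K]^i M) x k : ExteriorAlgebra K M)
  have hsum := DirectSum.sum_support_decompose (fun i : ℕ => ⋀[K]^i M) x
  have hc : ∀ k : ℕ, (k : K) • c k = 0 := by
    intro k
    have h1 : E x = ∑ i ∈ (DirectSum.decompose (fun i : ℕ => ⋀[K]^i M) x).support,
        (i : K) • c i := by
      conv_lhs => rw [← hsum]
      rw [map_sum]
      refine Finset.sum_congr rfl fun i _ => ?_
      rw [hE]
      exact sum_ι_mul_contractLeft b (SetLike.coe_mem _)
    rw [hEx] at h1
    have h2 := congrArg (fun y => (DirectSum.decompose (fun i : ℕ => ⋀[K]^i M) y k :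
      ExteriorAlgebra K M)) h1
    simp only [DirectSum.decompose_zero, DirectSum.decompose_sum, DirectSum.zero_apply,
      DirectSum.sum_apply, Submodule.coe_zero, AddSubmonoidClass.coe_finsetSum] at h2
    rw [Finset.sum_congr rfl (g := fun i => if i = k then (k : K) • c k else 0)] at h2
    · rw [Finset.sum_ite_eq'] at h2
      split_ifs at h2 with h3
      · exact h2.symm
      · rw [DFinsupp.notMem_support_iff] at h3
        simp [c, h3]
    · intro i _
      have hm : (i : K) • c i ∈ ⋀[K]^i M := Submodule.smul_mem _ _ (SetLike.coe_mem _)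
      split_ifs with h
      · subst h
        rw [DirectSum.decompose_of_mem_same (fun i : ℕ => ⋀[K]^i M) hm]
      · rw [DirectSum.decompose_of_mem_ne (fun i : ℕ => ⋀[K]^i M) hm h]
  have hx0 : x = c 0 := by
    conv_lhs => rw [← hsum]
    have h0 : ∀ i, i ≠ 0 → c i = 0 := fun i hi =>
      (smul_eq_zero.1 (hc i)).resolve_left (Nat.cast_ne_zero.2 hi)
    by_cases h : 0 ∈ (DirectSum.decompose (fun i : ℕ => ⋀[K]^i M) x).support
    · exact Finset.sum_eq_single_of_mem 0 h fun i _ hi => h0 i hi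
    · rw [Finset.sum_eq_zero fun i hi => h0 i fun h2 => h (h2 ▸ hi)]
      rw [DFinsupp.notMem_support_iff] at h
      simp [c, h]
  have hm : c 0 ∈ ⋀[K]^0 M := SetLike.coe_mem _
  rw [← hx0] at hm
  obtain ⟨r, hr⟩ := Submodule.mem_one.1
    ((pow_zero (LinearMap.range (ExteriorAlgebra.ι K (M := M)))).le hm)
  exact ⟨r, hr.symm⟩

variable {V : Type*} [NormedAddCommGroup V] [InnerProductSpace ℝ V]

lemma polar_negForm (u v : V) : QuadraticMap.polar (negForm V) u v = -2 * inner ℝ u v := by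
  simp only [QuadraticMap.polar, negForm_apply, inner_add_left, inner_add_right,
    real_inner_comm u v]
  ring

lemma inc_mul_inc (u v : V) :
    inc u * inc v = -(inc v * inc u) - algebraMap ℝ (Cl V) (2 * inner ℝ u v) := by
  have h := ι_mul_ι_add_swap (Q := negForm V) u v
  rw [polar_negForm, neg_mul, map_neg] at h
  rw [eq_sub_iff_add_eq, eq_neg_iff_add_eq_zero, add_right_comm, h, neg_add_cancel]

lemma inc_mul_self (u : V) : inc u * inc u = -algebraMap ℝ (Cl V) (inner ℝ u u) := by
  rw [ι_sq_scalar, negForm_apply, map_neg]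

/-- The twisted commutator with a vector is a contraction. -/
lemma inc_mul_sub_involute_mul (v : V) (a : Cl V) :
    inc v * a - involute a * inc v
      = contractLeft (QuadraticMap.polarBilin (negForm V) v) a := by
  induction a using CliffordAlgebra.left_induction with
  | algebraMap r =>
    rw [contractLeft_algebraMap, AlgHom.commutes, Algebra.commutes, sub_self]
  | add x y hx hy =>
    rw [map_add, map_add, ← hx, ← hy]
    noncomm_ring
  | ι_mul x u ih =>
    rw [contractLeft_ι_mul, ← ih, map_mul, involute_ι, QuadraticMap.polarBilin_apply_apply,
      Algebra.smul_def, ← ι_mul_ι_add_swap]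
    noncomm_ring

variable [FiniteDimensional ℝ V]

/-- The twisted centre of the Clifford algebra consists of the scalars. -/
lemma exists_algebraMap_of_involute_mul {a : Cl V} (ha : ∀ v, involute a * inc v = inc v * a) :
    ∃ r : ℝ, a = algebraMap ℝ (Cl V) r := by
  have : Invertible (2 : ℝ) := invertibleOfNonzero two_ne_zero
  have hd : ∀ d : Module.Dual ℝ V, contractLeft (Q := negForm V) d a = 0 := by
    intro d
    obtain ⟨v, hv⟩ : ∃ v : V, QuadraticMap.polarBilin (negForm V) v = d := by
      refine ⟨(-1 / 2 : ℝ) •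
          (InnerProductSpace.toDual ℝ V).symm (LinearMap.toContinuousLinearMap d),
        LinearMap.ext fun w => ?_⟩
      rw [QuadraticMap.polarBilin_apply_apply, polar_negForm, inner_smul_left,
        InnerProductSpace.toDual_symm_apply, LinearMap.coe_toContinuousLinearMap']
      simp
      ring
    rw [← hv, ← inc_mul_sub_involute_mul, ha, sub_self]
  obtain ⟨r, hr⟩ := exists_algebraMap_of_contractLeft_eq_zero (x := equivExterior (negForm V) a)
    fun d => by
      have h := changeForm_contractLeft (changeForm.associated_neg_proof (Q := negForm V)) d a
      rw [hd, map_zero] at h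
      exact h.symm
  refine ⟨r, (equivExterior (negForm V)).injective ?_⟩
  exact hr.trans (changeForm_algebraMap (changeForm.associated_neg_proof (Q := negForm V)) r).symm

/-- The kernel of `Pin(V) → O(V)` is `{1, -1}`. -/
lemma eq_one_or_of_pinProj_eq_one {a : Pin V} (ha : pinProj a = 1) : a = 1 ∨ a = pinNegOne V := by
  have h1 : ∀ v, involute ((a : (Cl V)ˣ) : Cl V) * inc v = inc v * ((a : (Cl V)ˣ) : Cl V) := by
    intro v
    have h := pinProj_spec a v
    rw [ha, LinearEquiv.coe_one, id] at h
    conv_rhs => rw [← h]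
    rw [mul_assoc _ _ (((a : (Cl V)ˣ) : Cl V)), Units.inv_mul, mul_one]
  obtain ⟨r, hr⟩ := exists_algebraMap_of_involute_mul h1
  have h2 := a.2.2
  have h3 : ((a : (Cl V)ˣ) : Cl V) * star ((a : (Cl V)ˣ) : Cl V) = 1 := by
    rw [h2, Units.mul_inv]
  rw [hr, star_algebraMap, ← map_mul, ← map_one (algebraMap ℝ (Cl V))] at h3
  have h4 := (algebraMap ℝ (Cl V)).injective h3
  rcases mul_self_eq_one_iff.1 h4 with rfl | rfl
  · left
    ext
    simpa using hr
  · right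
    ext
    simpa [pinNegOne] using hr

lemma eq_or_eq_of_pinProj_eq {a b : Pin V} (h : pinProj a = pinProj b) :
    a = b ∨ a = pinNegOne V * b := by
  have h1 : pinProj (a * b⁻¹) = 1 := by rw [map_mul, map_inv, h, mul_inv_cancel]
  rcases eq_one_or_of_pinProj_eq_one h1 with h2 | h2
  · exact Or.inl (mul_inv_eq_one.1 h2)
  · exact Or.inr (mul_inv_eq_iff_eq_mul.1 h2)

end Kernel

/-! ### Lifts of reflections to the Pin group -/

section Lift

open CliffordAlgebra

variable {V : Type*} [NormedAddCommGroup V] [InnerProductSpace ℝ V] [FiniteDimensional ℝ V]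

/-- A unit vector, as an element of `Pin(V)`. -/
def pinVec (u : V) (hu : inner ℝ u u = (1 : ℝ)) : Pin V :=
  ⟨⟨inc u, -inc u, by rw [mul_neg, inc_mul_self, hu, map_one, neg_neg],
      by rw [neg_mul, inc_mul_self, hu, map_one, neg_neg]⟩,
    fun v => ⟨v - (2 * inner ℝ u v) • u, by
      change involute (inc u) * inc v * -inc u = _
      rw [involute_ι, neg_mul, neg_mul_neg, ι_mul_ι_mul_ι, polar_negForm, negForm_apply, hu]
      congr 1
      module⟩, star_ι u⟩

lemma pinVec_coe (u : V) (hu : inner ℝ u u = (1 : ℝ)) :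
    (((pinVec u hu : Pin V) : (Cl V)ˣ) : Cl V) = inc u := rfl

lemma pinProj_pinVec (u : V) (hu : inner ℝ u u = (1 : ℝ)) (v : V) :
    pinProj (pinVec u hu) v = v - (2 * inner ℝ u v) • u := by
  apply inc_injective
  rw [← pinProj_spec]
  change involute (inc u) * inc v * -inc u = _
  rw [involute_ι, neg_mul, neg_mul_neg, ι_mul_ι_mul_ι, polar_negForm, negForm_apply, hu]
  congr 1
  module

lemma det_pinProj_pinVec (u : V) (hu : inner ℝ u u = (1 : ℝ)) :
    LinearMap.det (pinProj (pinVec u hu) : V →ₗ[ℝ] V) = -1 := by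
  have h : (pinProj (pinVec u hu) : V →ₗ[ℝ] V) = ((ℝ ∙ u)ᗮ).reflection.toLinearMap := by
    refine LinearMap.ext fun v => ?_
    have h1 : ‖u‖ = 1 := by
      rw [real_inner_self_eq_norm_sq] at hu
      nlinarith [norm_nonneg u]
    change pinProj (pinVec u hu) v = ((ℝ ∙ u)ᗮ).reflection v
    rw [pinProj_pinVec, Submodule.reflection_orthogonal_apply, Submodule.reflection_singleton_apply]
    simp [h1]
    module
  have hu0 : u ≠ 0 := by
    rintro rfl
    simp at hu
  rw [h, Submodule.det_reflection, Submodule.orthogonal_orthogonal, finrank_span_singleton hu0,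
    pow_one]

/-- An element of `Pin(V)` is homogeneous if it is even over a rotation or odd over an element of
determinant `-1`. -/
def IsHomogeneous (a : Pin V) : Prop :=
  involute ((a : (Cl V)ˣ) : Cl V)
    = LinearMap.det (pinProj a : V →ₗ[ℝ] V) • ((a : (Cl V)ˣ) : Cl V)

end Lift

section Homogeneous

open CliffordAlgebra

variable {V : Type*} [NormedAddCommGroup V] [InnerProductSpace ℝ V] [FiniteDimensional ℝ V]

lemma isHomogeneous_pinVec (u : V) (hu : inner ℝ u u = (1 : ℝ)) : IsHomogeneous (pinVec u hu) := by
  rw [IsHomogeneous, det_pinProj_pinVec, pinVec_coe, involute_ι, neg_one_smul]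

lemma isHomogeneous_one : IsHomogeneous (1 : Pin V) := by
  simp [IsHomogeneous]

lemma IsHomogeneous.mul {a b : Pin V} (ha : IsHomogeneous a) (hb : IsHomogeneous b) :
    IsHomogeneous (a * b) := by
  have h : (pinProj (a * b) : V →ₗ[ℝ] V) = (pinProj a : V →ₗ[ℝ] V) * (pinProj b : V →ₗ[ℝ] V) := by
    rw [map_mul]
    rfl
  rw [IsHomogeneous] at *
  rw [h, map_mul, Subgroup.coe_mul, Units.val_mul, map_mul, ha, hb, smul_mul_smul_comm]

lemma pinNegOne_mul_coe (b : Pin V) :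
    (((pinNegOne V * b : Pin V) : (Cl V)ˣ) : Cl V) = -((b : (Cl V)ˣ) : Cl V) := by
  simp [pinNegOne]

lemma IsHomogeneous.pinNegOne_mul {b : Pin V} (hb : IsHomogeneous b) :
    IsHomogeneous (pinNegOne V * b) := by
  rw [IsHomogeneous] at *
  rw [map_mul, pinProj_pinNegOne, one_mul, pinNegOne_mul_coe, map_neg, hb, smul_neg]

/-- An isometry without nonzero fixed vectors has determinant `(-1)^n`. -/
lemma det_eq_neg_one_pow {w : V ≃ₗ[ℝ] V} (hw : ∀ x y, inner ℝ (w x) (w y) = inner ℝ x y)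
    (h1 : ∀ v, w v = v → v = 0) :
    LinearMap.det (w : V →ₗ[ℝ] V) = (-1) ^ Module.finrank ℝ V := by
  set A : V →ₗ[ℝ] V := (w : V →ₗ[ℝ] V) with hA
  have h2 : LinearMap.adjoint A * A = 1 := by
    refine LinearMap.ext fun x => ext_inner_right ℝ fun y => ?_
    rw [Module.End.mul_apply, LinearMap.adjoint_inner_left]
    exact hw x y
  have h3 : LinearMap.adjoint A * (1 - A) = (-1 : ℝ) • LinearMap.adjoint (1 - A) := by
    rw [mul_sub, h2, mul_one, map_sub, LinearMap.adjoint_one, neg_one_smul, neg_sub]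
  have h4 : LinearMap.det (LinearMap.adjoint (1 - A)) = LinearMap.det (1 - A) := by
    let b := stdOrthonormalBasis ℝ V
    rw [← LinearMap.det_toMatrix b.toBasis, ← LinearMap.det_toMatrix b.toBasis (1 - A),
      LinearMap.toMatrix_adjoint, Matrix.det_conjTranspose, star_trivial]
  have h5 : LinearMap.det (1 - A) ≠ 0 := by
    rw [← isUnit_iff_ne_zero, ← LinearMap.isUnit_iff_isUnit_det, LinearMap.isUnit_iff_ker_eq_bot,
      LinearMap.ker_eq_bot']
    intro v hv
    exact h1 v (sub_eq_zero.1 hv).symm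
  have h6 := congrArg LinearMap.det h3
  rw [map_mul, LinearMap.det_smul, h4] at h6
  have h7 := congrArg LinearMap.det h2
  rw [map_mul, mul_right_cancel₀ h5 h6, map_one] at h7
  rcases neg_one_pow_eq_or ℝ (Module.finrank ℝ V) with h | h <;> rw [h] at h7 ⊢ <;> linarith

end Homogeneous

/-! ### The spin cover of the Weyl group -/

section Cover

open CliffordAlgebra

variable {ι V N : Type*} [NormedAddCommGroup V] [InnerProductSpace ℝ V]
  [AddCommGroup N] [Module ℝ N] (P : RootPairing ι ℝ V N)

lemma coroot'_eq
    (hinv : ∀ (i : ι) (x y : V), inner ℝ (P.reflection i x) (P.reflection i y) = inner ℝ x y)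
    (i : ι) (x : V) :
    P.coroot' i x = 2 * inner ℝ (P.root i) x / inner ℝ (P.root i) (P.root i) := by
  have h0 : inner ℝ (P.root i) (P.root i) ≠ (0 : ℝ) := inner_self_ne_zero.2 (P.ne_zero i)
  have h := hinv i x (P.root i)
  rw [P.reflection_apply_self, P.reflection_apply, inner_neg_right, inner_sub_left,
    real_inner_smul_left, real_inner_comm] at h
  field_simp
  linarith

/-- The normalized root. -/
def unitRoot (i : ι) : V := ‖P.root i‖⁻¹ • P.root i

lemma inner_unitRoot (i : ι) : inner ℝ (unitRoot P i) (unitRoot P i) = (1 : ℝ) := by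
  have h0 : ‖P.root i‖ ≠ 0 := norm_ne_zero_iff.2 (P.ne_zero i)
  rw [unitRoot, real_inner_smul_left, real_inner_smul_right, real_inner_self_eq_norm_sq]
  field_simp

variable {P}

lemma inner_weyl
    (hinv : ∀ (i : ι) (x y : V), inner ℝ (P.reflection i x) (P.reflection i y) = inner ℝ x y)
    {w : V ≃ₗ[ℝ] V} (hw : w ∈ weyl P) (x y : V) : inner ℝ (w x) (w y) = inner ℝ x y := by
  induction hw using Subgroup.closure_induction generalizing x y with
  | mem w hw =>
    obtain ⟨i, rfl⟩ := hw
    exact hinv i x y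
  | one => rfl
  | mul a b _ _ ha hb => rw [LinearEquiv.mul_apply, LinearEquiv.mul_apply, ha, hb]
  | inv a _ ha =>
    rw [← ha, ← LinearEquiv.mul_apply, ← LinearEquiv.mul_apply, mul_inv_cancel]
    rfl

lemma weyl_root_mem_range {w : V ≃ₗ[ℝ] V} (hw : w ∈ weyl P) (i : ι) :
    w (P.root i) ∈ Set.range P.root := by
  induction hw using Subgroup.closure_induction'' generalizing i with
  | mem w hw =>
    obtain ⟨j, rfl⟩ := hw
    exact ⟨P.reflectionPerm j i, P.root_reflectionPerm j i⟩
  | inv_mem w hw =>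
    obtain ⟨j, rfl⟩ := hw
    rw [P.reflection_inv]
    exact ⟨P.reflectionPerm j i, P.root_reflectionPerm j i⟩
  | one => exact ⟨i, rfl⟩
  | mul a b _ _ ha hb =>
    obtain ⟨j, hj⟩ := hb i
    rw [LinearEquiv.mul_apply, ← hj]
    exact ha j

instance [Finite ι] [P.IsRootSystem] : Finite (weyl P) := by
  refine Finite.of_injective
    (fun (w : weyl P) (i : ι) => (⟨_, weyl_root_mem_range w.2 i⟩ : Set.range P.root)) ?_
  intro w w' h
  refine Subtype.ext (LinearEquiv.toLinearMap_injective ?_)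
  refine LinearMap.ext_on_range (v := P.root) RootPairing.IsRootSystem.span_root_eq_top fun i => ?_
  exact congrArg Subtype.val (congrFun h i)

variable [FiniteDimensional ℝ V]

lemma pinProj_unitRoot
    (hinv : ∀ (i : ι) (x y : V), inner ℝ (P.reflection i x) (P.reflection i y) = inner ℝ x y)
    (i : ι) : pinProj (pinVec (unitRoot P i) (inner_unitRoot P i)) = P.reflection i := by
  ext v
  have h0 : ‖P.root i‖ ≠ 0 := norm_ne_zero_iff.2 (P.ne_zero i)
  rw [pinProj_pinVec, P.reflection_apply, coroot'_eq P hinv, unitRoot, real_inner_smul_left,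
    smul_smul, real_inner_self_eq_norm_sq]
  congr 2
  field_simp

lemma exists_isHomogeneous_lift
    (hinv : ∀ (i : ι) (x y : V), inner ℝ (P.reflection i x) (P.reflection i y) = inner ℝ x y)
    {w : V ≃ₗ[ℝ] V} (hw : w ∈ weyl P) : ∃ a : Pin V, IsHomogeneous a ∧ pinProj a = w := by
  induction hw using Subgroup.closure_induction'' with
  | mem w hw =>
    obtain ⟨i, rfl⟩ := hw
    exact ⟨_, isHomogeneous_pinVec _ _, pinProj_unitRoot hinv i⟩
  | inv_mem w hw =>
    obtain ⟨i, rfl⟩ := hw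
    refine ⟨_, isHomogeneous_pinVec _ _, (pinProj_unitRoot hinv i).trans ?_⟩
    rw [P.reflection_inv]
  | one => exact ⟨1, isHomogeneous_one, map_one _⟩
  | mul a b _ _ ha hb =>
    obtain ⟨a, ha, rfl⟩ := ha
    obtain ⟨b, hb, rfl⟩ := hb
    exact ⟨a * b, ha.mul hb, map_mul _ _ _⟩

lemma coverProj_surjective
    (hinv : ∀ (i : ι) (x y : V), inner ℝ (P.reflection i x) (P.reflection i y) = inner ℝ x y) :
    Function.Surjective (coverProj P) := by
  rintro ⟨w, hw⟩
  obtain ⟨a, -, ha⟩ := exists_isHomogeneous_lift hinv hw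
  refine ⟨⟨a, ?_⟩, Subtype.ext ha⟩
  rw [spinCover, Subgroup.mem_comap, ha]
  exact hw

lemma isHomogeneous_cover
    (hinv : ∀ (i : ι) (x y : V), inner ℝ (P.reflection i x) (P.reflection i y) = inner ℝ x y)
    (g : spinCover P) : IsHomogeneous (g : Pin V) := by
  obtain ⟨a, ha, hag⟩ := exists_isHomogeneous_lift hinv g.2
  rcases eq_or_eq_of_pinProj_eq hag.symm with h | h
  · rwa [h]
  · rw [h]
    exact ha.pinNegOne_mul

lemma eq_or_eq_of_coverProj_eq {g h : spinCover P} (hgh : coverProj P g = coverProj P h) :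
    g = h ∨ g = coverZ P * h := by
  have hp : pinProj (g : Pin V) = pinProj (h : Pin V) := congrArg Subtype.val hgh
  rcases eq_or_eq_of_pinProj_eq hp with h1 | h1
  · exact Or.inl (Subtype.ext h1)
  · exact Or.inr (Subtype.ext h1)

lemma coverProj_coverZ : coverProj P (coverZ P) = 1 := Subtype.ext pinProj_pinNegOne

instance [Finite ι] [P.IsRootSystem] : Finite (spinCover P) := by
  rw [← Set.finite_univ_iff]
  refine Set.Finite.of_finite_fibers (coverProj P) (Set.toFinite _) fun w _ => ?_
  by_cases hw : ∃ h, coverProj P h = w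
  · obtain ⟨h, rfl⟩ := hw
    refine ((Set.finite_singleton h).insert (coverZ P * h)).subset fun g hg => ?_
    exact (eq_or_eq_of_coverProj_eq hg.2).symm
  · refine Set.finite_empty.subset fun h hh => hw ⟨h, hh.2⟩

lemma coverAction_apply (g : spinCover P) : coverAction P g = pinProj (g : Pin V) := rfl

lemma isElliptic_coverAction_iff (g : spinCover P) :
    IsElliptic (coverAction P) g ↔ IsElliptic (weylAction P) (coverProj P g) := Iff.rfl

end Cover

/-! ### Zeros of the character of a spin module -/

section SpinCharacter

open CliffordAlgebra

variable {V : Type*} [NormedAddCommGroup V] [InnerProductSpace ℝ V]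

/-- A vector commutes, up to sign, with a product of `m` vectors, modulo products of `m - 1`
vectors. -/
lemma inc_mul_sub_mem (v : V) {m : ℕ} {x : Cl V} (hx : x ∈ LinearMap.range (inc (V := V)) ^ m) :
    (m = 0 → inc v * x = x * inc v) ∧
    ∀ k, m = k + 1 →
      inc v * x - (-1 : ℝ) ^ m • (x * inc v) ∈ LinearMap.range (inc (V := V)) ^ k := by
  induction hx using Submodule.pow_induction_on_left' with
  | algebraMap r => exact ⟨fun _ => (Algebra.commutes r _).symm, fun k hk => by omega⟩
  | add x y i hx hy ihx ihy =>
    refine ⟨fun h => by rw [mul_add, add_mul, ihx.1 h, ihy.1 h], fun k hk => ?_⟩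
    convert Submodule.add_mem _ (ihx.2 k hk) (ihy.2 k hk) using 1
    rw [mul_add, add_mul, smul_add]
    abel
  | mem_mul m hm i x hx ih =>
    obtain ⟨u, rfl⟩ := hm
    refine ⟨fun h => absurd h (Nat.succ_ne_zero i), fun k hk => ?_⟩
    obtain rfl : i = k := by omega
    have h1 : inc v * (inc u * x) - (-1 : ℝ) ^ i.succ • (inc u * x * inc v)
        = -(inc u * (inc v * x - (-1 : ℝ) ^ i • (x * inc v))) - (2 * inner ℝ v u : ℝ) • x := by
      rw [← mul_assoc, inc_mul_inc v u, sub_mul, neg_mul, ← Algebra.smul_def, mul_sub,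
        mul_smul_comm, mul_assoc, mul_assoc, Nat.succ_eq_add_one, pow_succ]
      module
    rw [h1]
    refine Submodule.sub_mem _ (Submodule.neg_mem _ ?_) (Submodule.smul_mem _ _ hx)
    rcases i with _ | i
    · rw [ih.1 rfl, show (-1 : ℝ) ^ 0 = 1 from pow_zero _, one_smul, sub_self, mul_zero]
      exact zero_mem _
    · rw [pow_succ']
      exact Submodule.mul_mem_mul ⟨u, rfl⟩ (ih.2 i rfl)

lemma mem_evenOdd_zero_of_involute_eq {x : Cl V} (hx : involute x = x) :
    x ∈ evenOdd (negForm V) 0 := by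
  have h : x ∈ evenOdd (negForm V) 0 ⊔ evenOdd (negForm V) 1 := by
    rw [(evenOdd_isCompl (negForm V)).sup_eq_top]
    trivial
  obtain ⟨e, he, o, ho, rfl⟩ := Submodule.mem_sup.1 h
  rw [map_add, involute_eq_of_mem_even he, involute_eq_of_mem_odd ho, add_right_inj] at hx
  have h2 : (2 : ℝ) • o = 0 := by
    rw [two_smul]
    nth_rewrite 1 [← hx]
    rw [neg_add_cancel]
  rw [(smul_eq_zero.1 h2).resolve_left two_ne_zero, add_zero]
  exact he

variable {M : Type*} [AddCommGroup M] [Module ℂ M]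

/-- The character of a Clifford module does not vanish on an even element over an isometry without
eigenvalue `-1`. If it did, it would vanish on `g x` for all even `x`, by induction on the degree
of `x`: moving a vector `v` around the trace, `tr (g y (v + w v)) = tr (g (y v + v y))`, where
`v + w v` is arbitrary and `y v + v y` has lower degree. Then `x = g⁻¹` gives a contradiction. -/
lemma trace_ne_zero_of_even [FiniteDimensional ℂ M] [Nontrivial M] (γ : Cl V →ₐ[ℝ] Module.End ℂ M)
    (g : (Cl V)ˣ) (hg : involute (g : Cl V) = g) (w : V → V)
    (hw : ∀ v, (g : Cl V) * inc v = inc (w v) * g)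
    (hsurj : ∀ u, ∃ v, v + w v = u) : LinearMap.trace ℂ M (γ g) ≠ 0 := by
  intro h0
  let τ : Cl V →ₗ[ℝ] ℂ := (LinearMap.trace ℂ M).restrictScalars ℝ ∘ₗ γ.toLinearMap
  have hτ : ∀ a b, τ (a * b) = τ (b * a) := by
    intro a b
    change LinearMap.trace ℂ M (γ (a * b)) = LinearMap.trace ℂ M (γ (b * a))
    rw [map_mul γ, map_mul γ, LinearMap.trace_mul_comm]
  have key : ∀ k, ∀ x ∈ LinearMap.range (inc (V := V)) ^ (2 * k), τ (g * x) = 0 := by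
    intro k
    induction k with
    | zero =>
      intro x hx
      rw [mul_zero, pow_zero] at hx
      obtain ⟨r, rfl⟩ := Submodule.mem_one.1 hx
      rw [← Algebra.commutes, ← Algebra.smul_def, map_smul]
      exact (congrArg (r • ·) h0).trans (smul_zero r)
    | succ k ih =>
      intro x hx
      rw [show 2 * (k + 1) = (2 * k + 1) + 1 by ring, pow_succ] at hx
      induction hx using Submodule.mul_induction_on' with
      | mem_mul_mem y hy u hu =>
        obtain ⟨u, rfl⟩ := hu
        obtain ⟨v, rfl⟩ := hsurj u
        have h1 : τ (g * (y * inc (w v))) = τ (g * (inc v * y)) := by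
          rw [← mul_assoc, hτ, ← mul_assoc, ← hw, mul_assoc]
        have h2 := ih _ ((inc_mul_sub_mem v hy).2 (2 * k) rfl)
        rw [Odd.neg_one_pow ⟨k, rfl⟩, neg_one_smul, sub_neg_eq_add, mul_add, map_add] at h2
        rw [map_add, mul_add, mul_add, map_add, h1, add_comm]
        exact h2
      | add x hx y hy hx' hy' => rw [mul_add, map_add, hx', hy', add_zero]
  have hall : ∀ x ∈ evenOdd (negForm V) 0, τ (g * x) = 0 := by
    intro x hx
    unfold evenOdd at hx
    induction hx using Submodule.iSup_induction' with
    | mem i x hx =>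
      obtain ⟨n, hn⟩ := i
      obtain ⟨k, rfl⟩ := (ZMod.natCast_eq_zero_iff_even.1 hn).exists_two_nsmul
      exact key k x (by simpa using hx)
    | zero => rw [mul_zero, map_zero]
    | add x y _ _ hx hy => rw [mul_add, map_add, hx, hy, add_zero]
  have hinv : involute (↑g⁻¹ : Cl V) = ↑g⁻¹ := by
    have h1 : (g : Cl V) * involute (↑g⁻¹ : Cl V) = 1 := by
      nth_rewrite 1 [← hg]
      rw [← map_mul, Units.mul_inv, map_one]
    exact (Units.inv_eq_of_mul_eq_one_right h1).symm
  have h1 := hall _ (mem_evenOdd_zero_of_involute_eq hinv)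
  rw [Units.mul_inv] at h1
  have h2 : τ 1 = Module.finrank ℂ M := by
    change LinearMap.trace ℂ M (γ 1) = _
    rw [map_one, LinearMap.trace_one]
  rw [h2, Nat.cast_eq_zero] at h1
  exact Module.finrank_pos.ne' h1

/-- The character of a Clifford module vanishes on an even element over an isometry with
eigenvalue `-1`: such an element anticommutes with an invertible vector. -/
lemma trace_eq_zero_of_anticommute (γ : Cl V →ₐ[ℝ] Module.End ℂ M) {g : Cl V} {θ : V} (hθ : θ ≠ 0)
    (h : g * inc θ = -(inc θ * g)) : LinearMap.trace ℂ M (γ g) = 0 := by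
  let τ : Cl V →ₗ[ℝ] ℂ := (LinearMap.trace ℂ M).restrictScalars ℝ ∘ₗ γ.toLinearMap
  have hτ : ∀ a b, τ (a * b) = τ (b * a) := by
    intro a b
    change LinearMap.trace ℂ M (γ (a * b)) = LinearMap.trace ℂ M (γ (b * a))
    rw [map_mul γ, map_mul γ, LinearMap.trace_mul_comm]
  have h1 : τ (inc θ * (g * inc θ)) = (inner ℝ θ θ : ℝ) • τ g := by
    rw [h, mul_neg, ← mul_assoc, inc_mul_self, neg_mul, neg_neg, ← Algebra.smul_def, map_smul]
  have h2 : τ (inc θ * (g * inc θ)) = -((inner ℝ θ θ : ℝ) • τ g) := by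
    rw [hτ, mul_assoc, inc_mul_self, mul_neg, ← Algebra.commutes, ← Algebra.smul_def, map_neg,
      map_smul]
  have h3 : (2 * inner ℝ θ θ : ℝ) • τ g = 0 := by
    rw [mul_smul, two_smul]
    nth_rewrite 1 [← h1]
    rw [h2, neg_add_cancel]
  exact (smul_eq_zero.1 h3).resolve_left
    (mul_ne_zero two_ne_zero (inner_self_ne_zero.2 hθ))

/-- Schur's lemma for a spin module. -/
lemma IsSpinModule.exists_eq_smul_one [FiniteDimensional ℂ M] {γ : Cl V →ₐ[ℝ] Module.End ℂ M}
    (hS : IsSpinModule γ) {T : Module.End ℂ M} (hT : ∀ a, T * γ a = γ a * T) :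
    ∃ c : ℂ, T = c • 1 := by
  have := hS.nontrivial
  obtain ⟨c, hc⟩ := Module.End.exists_eigenvalue T
  refine ⟨c, ?_⟩
  have hU := hS.simple (Module.End.eigenspace T c) fun a s hs => by
    rw [Module.End.mem_eigenspace_iff] at hs ⊢
    rw [← Module.End.mul_apply, hT, Module.End.mul_apply, hs, map_smul]
  rcases hU with h | h
  · exact absurd h hc
  · refine LinearMap.ext fun s => ?_
    have hs : s ∈ Module.End.eigenspace T c := by rw [h]; trivial
    rw [Module.End.mem_eigenspace_iff] at hs
    simpa using hs

variable [FiniteDimensional ℝ V]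

/-- The volume element: the product of an orthonormal basis is a homogeneous lift of `-1`. -/
lemma exists_lift_neg : ∃ ω : Pin V, IsHomogeneous ω ∧ ∀ v, pinProj ω v = -v := by
  let b := stdOrthonormalBasis ℝ V
  have hb : ∀ i j, inner ℝ (b i) (b j) = if i = j then (1 : ℝ) else 0 :=
    orthonormal_iff_ite.1 b.orthonormal
  let e : Fin (Module.finrank ℝ V) → Pin V := fun i => pinVec (b i) (by rw [hb, if_pos rfl])
  have hl : ∀ l : List (Fin (Module.finrank ℝ V)), l.Nodup → IsHomogeneous (l.map e).prod ∧
      ∀ j, pinProj (l.map e).prod (b j) = if j ∈ l then -b j else b j := by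
    intro l hl
    induction l with
    | nil => exact ⟨isHomogeneous_one, fun j => by simp⟩
    | cons i l ih =>
      obtain ⟨hil, hl⟩ := List.nodup_cons.1 hl
      obtain ⟨h1, h2⟩ := ih hl
      rw [List.map_cons, List.prod_cons]
      refine ⟨(isHomogeneous_pinVec _ _).mul h1, fun j => ?_⟩
      rw [map_mul, LinearEquiv.mul_apply, h2, pinProj_pinVec]
      by_cases hij : i = j
      · subst hij
        simp only [hil, if_false, List.mem_cons, true_or, if_true, hb]
        module
      · have hji : ¬ j = i := fun h => hij h.symm
        simp only [List.mem_cons, hji, false_or]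
        split_ifs <;> simp [hb, hij]
  obtain ⟨h1, h2⟩ := hl (List.finRange _) (List.nodup_finRange _)
  refine ⟨_, h1, fun v => ?_⟩
  have h3 : (pinProj ((List.finRange _).map e).prod : V →ₗ[ℝ] V) = -1 := by
    refine b.toBasis.ext fun j => ?_
    have := h2 j
    rw [if_pos (List.mem_finRange j)] at this
    simpa using this
  simpa using LinearMap.congr_fun h3 v

variable {ι N : Type*} [AddCommGroup N] [Module ℝ N] {P : RootPairing ι ℝ V N}

lemma spinRep_character (γ : Cl V →ₐ[ℝ] Module.End ℂ M) (g : spinCover P) :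
    (spinRep P γ).character g = LinearMap.trace ℂ M (γ ((g : Pin V) : (Cl V)ˣ)) := rfl

lemma mul_inc_of_isHomogeneous {g : Pin V} (hg : IsHomogeneous g) (v : V) :
    LinearMap.det (pinProj g : V →ₗ[ℝ] V) • (((g : (Cl V)ˣ) : Cl V) * inc v)
      = inc (pinProj g v) * ((g : (Cl V)ˣ) : Cl V) := by
  rw [← pinProj_spec, hg, smul_mul_assoc, smul_mul_assoc, smul_mul_assoc,
    Units.inv_mul_cancel_right]

lemma surjective_of_injective_add {w : V →ₗ[ℝ] V} (h : ∀ v, v + w v = 0 → v = 0) (u : V) :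
    ∃ v, v + w v = u := by
  have hinj : Function.Injective (LinearMap.id + w : V →ₗ[ℝ] V) :=
    (injective_iff_map_eq_zero _).2 h
  exact LinearMap.injective_iff_surjective.1 hinj u

/-- In even dimension, the character of `S` does not vanish on elliptic elements without
eigenvalue `-1`. -/
lemma character_ne_zero_of_even [FiniteDimensional ℂ M]
    (hinv : ∀ (i : ι) (x y : V), inner ℝ (P.reflection i x) (P.reflection i y) = inner ℝ x y)
    {γ : Cl V →ₐ[ℝ] Module.End ℂ M} (hS : IsSpinModule γ) (hn : Even (Module.finrank ℝ V))
    {g : spinCover P} (hg : IsElliptic (coverAction P) g)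
    (hg' : ∀ v, coverAction P g v = -v → v = 0) : (spinRep P γ).character g ≠ 0 := by
  have := hS.nontrivial
  have hdet : LinearMap.det (pinProj (g : Pin V) : V →ₗ[ℝ] V) = 1 := by
    rw [det_eq_neg_one_pow (inner_weyl hinv g.2) hg, hn.neg_one_pow]
  have hh := isHomogeneous_cover hinv g
  refine trace_ne_zero_of_even γ (g : Pin V) ?_ (pinProj (g : Pin V)) (fun v => ?_)
    (surjective_of_injective_add (w := (pinProj (g : Pin V) : V →ₗ[ℝ] V)) fun v hv => ?_)
  · rw [hh, hdet, one_smul]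
  · rw [← mul_inc_of_isHomogeneous hh, hdet, one_smul]
  · exact hg' v (eq_neg_of_add_eq_zero_right hv)

/-- In odd dimension, the character of `S` does not vanish on elliptic elements: multiplying by the
volume element, which is central and acts on `S` by a scalar, replaces `w` by `-w`. -/
lemma character_ne_zero_of_odd [FiniteDimensional ℂ M]
    (hinv : ∀ (i : ι) (x y : V), inner ℝ (P.reflection i x) (P.reflection i y) = inner ℝ x y)
    {γ : Cl V →ₐ[ℝ] Module.End ℂ M} (hS : IsSpinModule γ) (hn : Odd (Module.finrank ℝ V))
    {g : spinCover P} (hg : IsElliptic (coverAction P) g) : (spinRep P γ).character g ≠ 0 := by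
  have := hS.nontrivial
  have hdet : LinearMap.det (pinProj (g : Pin V) : V →ₗ[ℝ] V) = -1 := by
    rw [det_eq_neg_one_pow (inner_weyl hinv g.2) hg, hn.neg_one_pow]
  have hh := isHomogeneous_cover hinv g
  obtain ⟨ω, hω, hωv⟩ := exists_lift_neg (V := V)
  have hdetω : LinearMap.det (pinProj ω : V →ₗ[ℝ] V) = -1 := by
    have : (pinProj ω : V →ₗ[ℝ] V) = (-1 : ℝ) • 1 := by
      refine LinearMap.ext fun v => ?_
      simpa using hωv v
    rw [this, LinearMap.det_smul, map_one, mul_one, hn.neg_one_pow]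
  have hcomm : ∀ v, ((ω : (Cl V)ˣ) : Cl V) * inc v = inc v * ((ω : (Cl V)ˣ) : Cl V) := by
    intro v
    have h := mul_inc_of_isHomogeneous hω v
    rw [hdetω, hωv, map_neg, neg_mul, neg_one_smul, neg_inj] at h
    exact h
  have hcomm' : ∀ a : Cl V, ((ω : (Cl V)ˣ) : Cl V) * a = a * ((ω : (Cl V)ˣ) : Cl V) := by
    intro a
    induction a using CliffordAlgebra.induction with
    | algebraMap r => exact (Algebra.commutes r _).symm
    | ι v => exact hcomm v
    | mul a b ha hb => rw [← mul_assoc, ha, mul_assoc, hb, mul_assoc]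
    | add a b ha hb => rw [mul_add, add_mul, ha, hb]
  obtain ⟨c, hc⟩ := hS.exists_eq_smul_one (T := γ ((ω : (Cl V)ˣ) : Cl V)) fun a => by
    rw [← map_mul, hcomm', map_mul]
  intro h0
  refine trace_ne_zero_of_even γ (ω * (g : Pin V) : (Cl V)ˣ) ?_ (fun v => -pinProj (g : Pin V) v)
    (fun v => ?_) (surjective_of_injective_add (w := -(pinProj (g : Pin V) : V →ₗ[ℝ] V))
      fun v hv => ?_) ?_
  · have := hω.mul hh
    rw [IsHomogeneous, map_mul] at this
    rw [Units.val_mul, map_mul, hω, hh, hdetω, hdet]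
    simp
  · have h1 := mul_inc_of_isHomogeneous hh v
    rw [hdet, neg_one_smul] at h1
    rw [Units.val_mul, mul_assoc, neg_eq_iff_eq_neg.1 h1, map_neg, neg_mul, mul_neg, ← mul_assoc,
      hcomm, mul_assoc]
  · refine hg v ?_
    have : v + -pinProj (g : Pin V) v = 0 := hv
    exact (add_neg_eq_zero.1 this).symm
  · rw [Units.val_mul, map_mul, hc, smul_mul_assoc, one_mul, map_smul]
    rw [spinRep_character] at h0
    rw [h0, smul_zero]

/-- In even dimension, the character of `S` vanishes on the lifts of an element of determinant `1`
with eigenvalue `-1`. -/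
lemma character_eq_zero
    (hinv : ∀ (i : ι) (x y : V), inner ℝ (P.reflection i x) (P.reflection i y) = inner ℝ x y)
    (γ : Cl V →ₐ[ℝ] Module.End ℂ M) {g : spinCover P}
    (hdet : LinearMap.det (coverAction P g : V →ₗ[ℝ] V) = 1) {θ : V} (hθ : θ ≠ 0)
    (hg : coverAction P g θ = -θ) : (spinRep P γ).character g = 0 := by
  refine trace_eq_zero_of_anticommute γ hθ ?_
  have h := mul_inc_of_isHomogeneous (isHomogeneous_cover hinv g) θ
  rw [coverAction_apply] at hdet hg
  rwa [hdet, one_smul, hg, map_neg, neg_mul] at h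

end SpinCharacter

/-! ### The map `σ ↦ σ ⊗ S` on elliptic quotients -/

section TensorMap

variable {ι V N S : Type*} [NormedAddCommGroup V] [InnerProductSpace ℝ V] [FiniteDimensional ℝ V]
  [AddCommGroup N] [Module ℝ N] {P : RootPairing ι ℝ V N} [AddCommGroup S] [Module ℂ S]

lemma spinRep_coverZ (γ : Cl V →ₐ[ℝ] Module.End ℂ S) : spinRep P γ (coverZ P) = -1 := by
  change γ (-1) = -1
  rw [map_neg, map_one]

lemma spinRep_character_coverZ_mul (γ : Cl V →ₐ[ℝ] Module.End ℂ S) (g : spinCover P) :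
    (spinRep P γ).character (coverZ P * g) = -(spinRep P γ).character g := by
  rw [Representation.character, map_mul, spinRep_coverZ, neg_one_mul, map_neg]
  rfl

lemma apply_coverZ_mul_of_mem_genuineSpace {f : repSpace (spinCover P)} (hf : f ∈ genuineSpace P)
    (g : spinCover P) :
    (f : spinCover P → ℂ) (coverZ P * g) = -(f : spinCover P → ℂ) g := by
  induction hf using Submodule.span_induction with
  | mem f hf =>
    obtain ⟨n, ρ, -, hz, h⟩ := hf
    have h1 : ρ (coverZ P * g) = -ρ g := by
      rw [map_mul, hz]
      exact neg_one_mul (ρ g)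
    rw [h, Representation.character, h1, map_neg]
    rfl
  | zero => simp
  | add f f' _ _ h h' =>
    rw [Submodule.coe_add, Pi.add_apply, Pi.add_apply, h, h']
    ring
  | smul c f _ h =>
    rw [Submodule.coe_smul, Pi.smul_apply, Pi.smul_apply, h, smul_neg]

lemma mem_genuineSpace_of_mem_span {f : repSpace (spinCover P)}
    (hf : (f : spinCover P → ℂ) ∈ Submodule.span ℂ {f : spinCover P → ℂ |
      ∃ (n : ℕ) (σ : Representation ℂ (spinCover P) (Fin n → ℂ)),
        σ.IsIrreducible ∧ σ (coverZ P) = -1 ∧ f = σ.character}) : f ∈ genuineSpace P := by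
  have h : Submodule.span ℂ {f : spinCover P → ℂ |
      ∃ (n : ℕ) (σ : Representation ℂ (spinCover P) (Fin n → ℂ)),
        σ.IsIrreducible ∧ σ (coverZ P) = -1 ∧ f = σ.character}
      ≤ (genuineSpace P).map (repSpace (spinCover P)).subtype := by
    rw [Submodule.span_le]
    rintro _ ⟨n, σ, h1, h2, rfl⟩
    exact ⟨⟨σ.character, character_mem_repSpace σ⟩, Submodule.subset_span ⟨n, σ, h1, h2, rfl⟩, rfl⟩
  obtain ⟨f', hf', h'⟩ := h hf
  rwa [← Subtype.ext h']

variable [FiniteDimensional ℂ S]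

lemma tensorS_apply (γ : Cl V →ₐ[ℝ] Module.End ℂ S) (σ : repSpace (weyl P)) (g : spinCover P) :
    (tensorS P γ σ : spinCover P → ℂ) g
      = (σ : weyl P → ℂ) (coverProj P g) * (spinRep P γ).character g := rfl

variable [Finite ι] [P.IsRootSystem]

lemma tensorS_mem_genuineSpace (γ : Cl V →ₐ[ℝ] Module.End ℂ S) (σ : repSpace (weyl P)) :
    tensorS P γ σ ∈ genuineSpace P := by
  have h : repSpace (weyl P) ≤
      ((genuineSpace P).map (repSpace (spinCover P)).subtype).comap (tensorFun P γ) := by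
    refine Submodule.span_le.2 ?_
    rintro _ ⟨n, ρ, rfl⟩
    refine ⟨⟨_, tensorFun_mem P γ _ (character_mem_repSpace ρ)⟩,
      mem_genuineSpace_of_mem_span ?_, rfl⟩
    change tensorFun P γ ρ.character ∈ _
    rw [tensorFun_character]
    refine character_mem_span_irreducible (coverZ P) _ ?_
    rw [Representation.tprod_apply, spinRep_coverZ, MonoidHom.comp_apply, coverProj_coverZ, map_one]
    refine TensorProduct.ext' fun x y => ?_
    simp [TensorProduct.tmul_neg]
  obtain ⟨f, hf, hf'⟩ := h σ.2
  rwa [← show f = tensorS P γ σ from Subtype.ext hf']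

variable (P) in
/-- The map induced by `σ ↦ σ ⊗ S` on the elliptic quotients. -/
def tensorBar (γ : Cl V →ₐ[ℝ] Module.End ℂ S) : RbarW P →ₗ[ℂ] RbarGen P :=
  Submodule.liftQ _ (((ellipticRadical (coverAction P)).mkQ ∘ₗ tensorS P γ).codRestrict (RbarGen P)
    fun σ => Submodule.mem_map_of_mem (tensorS_mem_genuineSpace γ σ)) (by
      intro σ hσ
      refine LinearMap.mem_ker.2 (Subtype.ext ?_)
      refine (Submodule.Quotient.mk_eq_zero _).2 ((mem_ellipticRadical_iff _ _).2 fun g hg => ?_)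
      rw [tensorS_apply, (mem_inducedSpace_iff _ σ.2).1 hσ _ hg, zero_mul])

lemma tensorBar_mk (γ : Cl V →ₐ[ℝ] Module.End ℂ S) (σ : repSpace (weyl P)) :
    (tensorBar P γ (Submodule.Quotient.mk σ) : RbarCover P)
      = Submodule.Quotient.mk (tensorS P γ σ) := rfl

/-- If the character of `S` has no zeros on elliptic elements, one can divide by it. -/
lemma bijective_tensorBar
    (hinv : ∀ (i : ι) (x y : V), inner ℝ (P.reflection i x) (P.reflection i y) = inner ℝ x y)
    {γ : Cl V →ₐ[ℝ] Module.End ℂ S}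
    (hχ : ∀ g, IsElliptic (coverAction P) g → (spinRep P γ).character g ≠ 0) :
    Function.Bijective (tensorBar P γ) := by
  classical
  constructor
  · rw [injective_iff_map_eq_zero]
    intro x hx
    obtain ⟨σ, rfl⟩ := Submodule.Quotient.mk_surjective _ x
    have h1 : (Submodule.Quotient.mk (tensorS P γ σ) : RbarCover P) = 0 := by
      rw [← tensorBar_mk, hx]
      rfl
    rw [Submodule.Quotient.mk_eq_zero, mem_ellipticRadical_iff] at h1
    refine (Submodule.Quotient.mk_eq_zero _).2 ((mem_inducedSpace_iff _ σ.2).2 ?_)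
    intro w hw
    obtain ⟨g, rfl⟩ := coverProj_surjective hinv w
    have h2 := h1 g hw
    rw [tensorS_apply] at h2
    exact (mul_eq_zero.1 h2).resolve_right (hχ g hw)
  · rintro ⟨_, f, hf, rfl⟩
    have hsurj := coverProj_surjective (P := P) hinv
    let q : spinCover P → ℂ := fun g =>
      if IsElliptic (coverAction P) g then (f : spinCover P → ℂ) g / (spinRep P γ).character g
      else 0
    have hq : ∀ g g', coverProj P g = coverProj P g' → q g = q g' := by
      intro g g' h
      have he : IsElliptic (coverAction P) g ↔ IsElliptic (coverAction P) g' := by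
        rw [isElliptic_coverAction_iff, h, isElliptic_coverAction_iff]
      simp only [q, he]
      refine if_congr Iff.rfl ?_ rfl
      rcases eq_or_eq_of_coverProj_eq h with rfl | rfl
      · rfl
      · rw [apply_coverZ_mul_of_mem_genuineSpace hf, spinRep_character_coverZ_mul, neg_div_neg_eq]
    let h : weyl P → ℂ := fun w => q (Function.surjInv hsurj w)
    have hh : ∀ g, h (coverProj P g) = q g := fun g => hq _ _ (Function.surjInv_eq hsurj _)
    have hmem : h ∈ repSpace (weyl P) := by
      refine mem_repSpace_iff.2 fun x y => ?_
      obtain ⟨a, rfl⟩ := hsurj x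
      obtain ⟨b, rfl⟩ := hsurj y
      rw [← map_inv, ← map_mul, ← map_mul, hh, hh]
      have he : IsElliptic (coverAction P) (a * b * a⁻¹) ↔ IsElliptic (coverAction P) b := by
        refine ⟨fun h => ?_, fun h => isElliptic_conj h a⟩
        simpa [mul_assoc] using isElliptic_conj h a⁻¹
      simp only [q, he, repSpace_conj f.2, Representation.char_conj]
    refine ⟨Submodule.Quotient.mk ⟨h, hmem⟩, Subtype.ext ?_⟩
    rw [tensorBar_mk]
    refine (Submodule.Quotient.eq _).2 ((mem_ellipticRadical_iff _ _).2 fun g hg => ?_)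
    rw [Submodule.coe_sub, Pi.sub_apply, tensorS_apply]
    simp only [hh, q, hg, if_true]
    rw [div_mul_cancel₀ _ (hχ g hg), sub_self]

/-- If the map on elliptic quotients is injective, the character of `S` has no zeros on elliptic
elements: otherwise the indicator function of a conjugacy class is in the kernel. -/
lemma character_ne_zero_of_injective_tensorBar {γ : Cl V →ₐ[ℝ] Module.End ℂ S}
    (hinv : ∀ (i : ι) (x y : V), inner ℝ (P.reflection i x) (P.reflection i y) = inner ℝ x y)
    (h : Function.Injective (tensorBar P γ)) {g : spinCover P} (hg : IsElliptic (coverAction P) g) :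
    (spinRep P γ).character g ≠ 0 := by
  classical
  intro h0
  let σ : weyl P → ℂ := fun w => if IsConj (coverProj P g) w then 1 else 0
  have hσ : σ ∈ repSpace (weyl P) := by
    refine mem_repSpace_iff.2 fun x y => if_congr ⟨fun h => h.trans ?_, fun h => h.trans ?_⟩ rfl rfl
    · exact (isConj_iff.2 ⟨x, rfl⟩).symm
    · exact isConj_iff.2 ⟨x, rfl⟩
  have h1 : tensorBar P γ (Submodule.Quotient.mk ⟨σ, hσ⟩) = 0 := by
    refine Subtype.ext ?_
    rw [tensorBar_mk]
    refine (Submodule.Quotient.mk_eq_zero _).2 ((mem_ellipticRadical_iff _ _).2 fun g' _ => ?_)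
    rw [tensorS_apply]
    by_cases hc : IsConj (coverProj P g) (coverProj P g')
    · obtain ⟨x, hx⟩ := isConj_iff.1 hc
      obtain ⟨a, rfl⟩ := coverProj_surjective hinv x
      rw [← map_inv, ← map_mul, ← map_mul] at hx
      have h2 : (spinRep P γ).character (a * g * a⁻¹) = 0 := by
        rw [Representation.char_conj, h0]
      rcases eq_or_eq_of_coverProj_eq hx.symm with rfl | rfl
      · rw [h2, mul_zero]
      · rw [spinRep_character_coverZ_mul, h2, neg_zero, mul_zero]
    · rw [show ((⟨σ, hσ⟩ : repSpace (weyl P)) : weyl P → ℂ) (coverProj P g') = 0 from if_neg hc,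
        zero_mul]
  have h2 := (injective_iff_map_eq_zero _).1 h _ h1
  have h2' : (⟨σ, hσ⟩ : repSpace (weyl P)) ∈
      (inducedSpace (weylAction P)).submoduleOf (repSpace (weyl P)) :=
    (Submodule.Quotient.mk_eq_zero _).1 h2
  have h3 := (mem_inducedSpace_iff _ hσ).1 h2' (coverProj P g) hg
  exact one_ne_zero ((if_pos (IsConj.refl (coverProj P g))).symm.trans h3)

end TensorMap

/-! ### Elliptic elements in type `A` -/

section TypeA

/-- An odd number of signs cannot cancel. -/
lemma eq_zero_of_sum_eq_zero_of_sq_eq {m : ℕ} (hm : Odd m) {f : Fin m → ℝ} (hsum : ∑ x, f x = 0)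
    (hsq : ∀ x y, f x ^ 2 = f y ^ 2) : f = 0 := by
  classical
  funext y
  by_contra hy
  have h1 : ∀ x, f x = (if f x = f y then (1 : ℤ) else -1 : ℤ) * f y := by
    intro x
    rcases sq_eq_sq_iff_eq_or_eq_neg.1 (hsq x y) with h | h
    · simp [h]
    · have : f x ≠ f y := by
        rw [h]
        intro h'
        exact hy (by simpa using (by linarith : f y = 0))
      rw [if_neg this, h]
      simp
  have h2 : ((∑ x, if f x = f y then (1 : ℤ) else -1 : ℤ) : ℝ) * f y = 0 := by
    rw [Int.cast_sum, Finset.sum_mul, ← hsum]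
    exact Finset.sum_congr rfl fun x _ => (h1 x).symm
  have h3 : (∑ x : Fin m, if f x = f y then (1 : ℤ) else -1) = 0 := by
    exact_mod_cast (mul_eq_zero.1 h2).resolve_right hy
  have h4 : (m : ZMod 2) = 0 := by
    have h5 := congrArg (Int.cast : ℤ → ZMod 2) h3
    rw [Int.cast_sum, Int.cast_zero] at h5
    rw [← h5, Finset.sum_congr rfl (g := fun _ => (1 : ZMod 2))]
    · simp
    · intro x _
      split_ifs
      · simp
      · decide
  rw [ZMod.natCast_eq_zero_iff_even] at h4
  exact (Nat.not_even_iff_odd.2 hm) h4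

variable {ι V N : Type*} [NormedAddCommGroup V] [InnerProductSpace ℝ V]
  [AddCommGroup N] [Module ℝ N] {P : RootPairing ι ℝ V N} [P.IsRootSystem]

lemma eq_zero_of_coroot'_eq_zero (b : P.Base) {v : V} (hv : ∀ k ∈ b.support, P.coroot' k v = 0) :
    v = 0 := by
  have h : P.toLinearMap v = 0 := by
    refine b.toCoweightBasis.ext fun k => ?_
    rw [b.toCoweightBasis_apply]
    exact hv k k.2
  exact (map_eq_zero_iff _ P.toPerfPair.injective).1 h

/-- For a base indexed by `Fin n`, the linear map with `α_k ↦ ε_k - ε_{k+1}`. -/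
def toCoordinates (b : P.Base) {n : ℕ} (e : b.support ≃ Fin n) : V →ₗ[ℝ] (Fin (n + 1) → ℝ) :=
  b.toWeightBasis.constr ℝ fun k => Pi.single (e k).castSucc 1 - Pi.single (e k).succ 1

variable {b : P.Base} {n : ℕ} {e : b.support ≃ Fin n}

lemma toCoordinates_root (k : b.support) :
    toCoordinates b e (P.root k) = Pi.single (e k).castSucc 1 - Pi.single (e k).succ 1 := by
  rw [← b.toWeightBasis_apply, toCoordinates, Module.Basis.constr_basis]

lemma sum_toCoordinates (v : V) : ∑ x, toCoordinates b e v x = 0 := by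
  have h : (∑ x, LinearMap.proj x) ∘ₗ toCoordinates b e = 0 := by
    refine b.toWeightBasis.ext fun k => ?_
    rw [b.toWeightBasis_apply, LinearMap.comp_apply, toCoordinates_root]
    simp [LinearMap.sum_apply]
  simpa [LinearMap.sum_apply] using LinearMap.congr_fun h v

lemma finrank_eq_of_base (e : b.support ≃ Fin n) : Module.finrank ℝ V = n := by
  rw [Module.finrank_eq_card_basis b.toWeightBasis, Fintype.card_congr e, Fintype.card_fin]

variable [P.IsCrystallographic]

lemma coroot'_eq_toCoordinates (hA : b.cartanMatrix.reindex e e = CartanMatrix.A n)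
    (k : b.support) (v : V) :
    P.coroot' k v = toCoordinates b e v (e k).castSucc - toCoordinates b e v (e k).succ := by
  have h : P.coroot' k = ((LinearMap.proj (e k).castSucc : (Fin (n + 1) → ℝ) →ₗ[ℝ] ℝ)
      - LinearMap.proj (e k).succ) ∘ₗ toCoordinates b e := by
    refine b.toWeightBasis.ext fun l => ?_
    have h1 : b.cartanMatrix l k = CartanMatrix.A n (e l) (e k) := by
      rw [← hA]
      simp
    have h2 : P.coroot' k (P.root l) = (CartanMatrix.A n (e l) (e k) : ℤ) := by
      rw [← h1, RootPairing.root_coroot'_eq_pairing]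
      exact (P.algebraMap_pairingIn ℤ l k).symm
    rw [b.toWeightBasis_apply, h2, LinearMap.comp_apply, toCoordinates_root]
    simp only [CartanMatrix.A, Matrix.of_apply, LinearMap.sub_apply, LinearMap.proj_apply,
      Pi.sub_apply, Pi.single_apply, Fin.ext_iff, Fin.val_castSucc, Fin.val_succ]
    split_ifs <;> first | omega | norm_num
  rw [h]
  rfl

lemma toCoordinates_injective (hA : b.cartanMatrix.reindex e e = CartanMatrix.A n) :
    Function.Injective (toCoordinates b e) := by
  refine (injective_iff_map_eq_zero _).2 fun v hv => ?_
  refine eq_zero_of_coroot'_eq_zero b fun k hk => ?_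
  rw [coroot'_eq_toCoordinates hA ⟨k, hk⟩, hv]
  simp

lemma exists_toCoordinates_eq (hA : b.cartanMatrix.reindex e e = CartanMatrix.A n)
    {f : Fin (n + 1) → ℝ} (hf : ∑ x, f x = 0) : ∃ v, toCoordinates b e v = f := by
  let s : (Fin (n + 1) → ℝ) →ₗ[ℝ] ℝ := ∑ x, LinearMap.proj x
  have hs : ∀ g, s g = ∑ x, g x := fun g => by simp [s, LinearMap.sum_apply]
  have h1 : LinearMap.range (toCoordinates b e) ≤ LinearMap.ker s := by
    rintro _ ⟨v, rfl⟩
    rw [LinearMap.mem_ker, hs, sum_toCoordinates]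
  have h2 : LinearMap.range s = ⊤ := by
    refine LinearMap.range_eq_top.2 fun c => ⟨Pi.single 0 c, ?_⟩
    rw [hs]
    simp
  have h3 := s.finrank_range_add_finrank_ker
  rw [h2, finrank_top, Module.finrank_self, Module.finrank_fin_fun] at h3
  have h4 : LinearMap.range (toCoordinates b e) = LinearMap.ker s := by
    refine Submodule.eq_of_le_of_finrank_eq h1 ?_
    rw [LinearMap.finrank_range_of_inj (toCoordinates_injective hA), finrank_eq_of_base e]
    omega
  have h5 : f ∈ LinearMap.ker s := by rw [LinearMap.mem_ker, hs, hf]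
  rwa [← h4] at h5

/-- In type `A` the Weyl group acts on the coordinates by permutations. -/
lemma exists_perm_of_mem_weyl [Finite ι] [P.IsReduced]
    (hA : b.cartanMatrix.reindex e e = CartanMatrix.A n)
    {w : V ≃ₗ[ℝ] V} (hw : w ∈ weyl P) :
    ∃ σ : Equiv.Perm (Fin (n + 1)),
      ∀ v x, toCoordinates b e (w v) x = toCoordinates b e v (σ x) := by
  have hmul : ∀ w w' : V ≃ₗ[ℝ] V,
      (∃ σ : Equiv.Perm (Fin (n + 1)),
        ∀ v x, toCoordinates b e (w v) x = toCoordinates b e v (σ x)) →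
      (∃ σ : Equiv.Perm (Fin (n + 1)),
        ∀ v x, toCoordinates b e (w' v) x = toCoordinates b e v (σ x)) →
      ∃ σ : Equiv.Perm (Fin (n + 1)),
        ∀ v x, toCoordinates b e ((w * w') v) x = toCoordinates b e v (σ x) := by
    rintro w w' ⟨σ, h⟩ ⟨σ', h'⟩
    exact ⟨σ' * σ, fun v x => by rw [LinearEquiv.mul_apply, h, h', Equiv.Perm.mul_apply]⟩
  have hsimple : ∀ i ∈ b.support, ∃ σ : Equiv.Perm (Fin (n + 1)),
      ∀ v x, toCoordinates b e (P.reflection i v) x = toCoordinates b e v (σ x) := by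
    intro i hi
    refine ⟨Equiv.swap (e ⟨i, hi⟩).castSucc (e ⟨i, hi⟩).succ, fun v x => ?_⟩
    have hne : (e ⟨i, hi⟩).castSucc ≠ (e ⟨i, hi⟩).succ := (Fin.castSucc_lt_succ).ne
    rw [P.reflection_apply, map_sub, map_smul, coroot'_eq_toCoordinates hA ⟨i, hi⟩ v,
      toCoordinates_root ⟨i, hi⟩, Pi.sub_apply, Pi.smul_apply, Pi.sub_apply, smul_eq_mul]
    rcases eq_or_ne x (e ⟨i, hi⟩).castSucc with rfl | h1
    · rw [Equiv.swap_apply_left, Pi.single_eq_same, Pi.single_eq_of_ne hne]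
      ring
    · rcases eq_or_ne x (e ⟨i, hi⟩).succ with rfl | h2
      · rw [Equiv.swap_apply_right, Pi.single_eq_same, Pi.single_eq_of_ne hne.symm]
        ring
      · rw [Equiv.swap_apply_of_ne_of_ne h1 h2, Pi.single_eq_of_ne h1, Pi.single_eq_of_ne h2]
        ring
  have hrefl : ∀ i, ∃ σ : Equiv.Perm (Fin (n + 1)),
      ∀ v x, toCoordinates b e (P.reflection i v) x = toCoordinates b e v (σ x) := by
    intro i
    induction i using b.induction_reflect with
    | h₀ i hi =>
      rwa [show P.reflection (P.reflectionPerm i i) = P.reflection i by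
        rw [P.reflection_reflectionPerm]; ext v; simp]
    | h₁ i hi => exact hsimple i hi
    | h₂ i j hi hj =>
      have hj' := hsimple j hj
      rw [P.reflection_reflectionPerm]
      exact hmul _ _ (hmul _ _ hj' hi) hj'
  induction hw using Subgroup.closure_induction with
  | mem w hw =>
    obtain ⟨i, rfl⟩ := hw
    exact hrefl i
  | one => exact ⟨1, fun v x => rfl⟩
  | mul w w' _ _ h h' => exact hmul w w' h h'
  | inv w _ h =>
    obtain ⟨σ, h⟩ := h
    refine ⟨σ⁻¹, fun v x => ?_⟩
    have h1 := h (w⁻¹ v) (σ⁻¹ x)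
    rw [← LinearEquiv.mul_apply, mul_inv_cancel, ← Equiv.Perm.mul_apply, mul_inv_cancel] at h1
    exact h1.symm

/-- In type `A_n` with `n` even, an elliptic element does not have the eigenvalue `-1`. A function
on `n + 1` points that is invariant under the corresponding permutation is constant; this applies
to the square of an eigenvector. -/
lemma eq_zero_of_isTypeA [Finite ι] [P.IsReduced] (hA : IsTypeA P)
    (hn : Even (Module.finrank ℝ V)) {w : V ≃ₗ[ℝ] V} (hw : w ∈ weyl P) (hell : ∀ v, w v = v → v = 0)
    {v : V} (hv : w v = -v) : v = 0 := by
  obtain ⟨b, n, e, hA⟩ := hA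
  rw [finrank_eq_of_base e] at hn
  obtain ⟨σ, hσ⟩ := exists_perm_of_mem_weyl hA hw
  have hconst : ∀ f : Fin (n + 1) → ℝ, (∀ x, f (σ x) = f x) → ∀ x y, f x = f y := by
    intro f hf x y
    let c : ℝ := (∑ x, f x) / (n + 1)
    obtain ⟨u, hu⟩ := exists_toCoordinates_eq (b := b) (e := e) hA (f := fun x => f x - c) (by
      have : (n + 1 : ℝ) ≠ 0 := by positivity
      simp only [Finset.sum_sub_distrib, c, Finset.sum_const, Finset.card_univ, Fintype.card_fin,
        nsmul_eq_mul]
      push_cast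
      field_simp
      ring)
    have hfix : w u = u := by
      refine toCoordinates_injective hA (funext fun x => ?_)
      rw [hσ, hu]
      simp only [hf]
    rw [hell u hfix, map_zero] at hu
    have hx := congrFun hu x
    have hy := congrFun hu y
    simp only [Pi.zero_apply] at hx hy
    linarith
  refine toCoordinates_injective hA ?_
  rw [map_zero]
  refine eq_zero_of_sum_eq_zero_of_sq_eq hn.add_one (sum_toCoordinates v)
    (hconst (fun x => toCoordinates b e v x ^ 2) fun x => ?_)
  rw [← hσ, hv, map_neg, Pi.neg_apply, neg_sq]

end TypeA

/-! ### A characterisation of the Cartan matrix of type `A` -/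

section Chain

variable {κ : Type*}

/-- The vertices `v 0 = i, v 1, …, v t` form a simply laced path in the diagram of `A`, all with
label `1`; the vertices before `v t` have no neighbours outside the path and are different
from `j`. -/
structure IsDiagramPath (A : Matrix κ κ ℤ) (m : κ → ℤ) (i j : κ) (v : ℕ → κ) (t : ℕ) : Prop where
  zero : v 0 = i
  inj : ∀ s ≤ t, ∀ s' ≤ t, v s = v s' → s = s'
  label : ∀ s ≤ t, m (v s) = 1
  adj : ∀ s < t, A (v s) (v (s + 1)) = -1 ∧ A (v (s + 1)) (v s) = -1
  nbr : ∀ s < t, ∀ l, A l (v s) ≠ 0 → ∃ s', l = v s' ∧ s' ≤ s + 1 ∧ s ≤ s' + 1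
  ne : ∀ s < t, v s ≠ j

variable {A : Matrix κ κ ℤ} {m : κ → ℤ} {i j : κ}

/-- A path that cannot be extended is the whole diagram. -/
lemma IsDiagramPath.exists_equiv {v : ℕ → κ} {t : ℕ} (h : IsDiagramPath A m i j v t)
    (hdiag : ∀ l, A l l = 2) (hsymm : ∀ l k, A l k = 0 → A k l = 0)
    (hconn : ∀ p : κ → Prop, p i → (∀ l k, p l → A k l ≠ 0 → p k) → ∀ k, p k)
    (hext : ∀ l, A l (v t) ≠ 0 → ∃ s ≤ t, l = v s) :
    ∃ (n : ℕ) (e : κ ≃ Fin n), A.reindex e e = CartanMatrix.A n := by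
  have hall : ∀ k, ∃ s ≤ t, k = v s := by
    refine hconn _ ⟨0, Nat.zero_le _, h.zero.symm⟩ ?_
    rintro _ k ⟨s, hs, rfl⟩ hk
    rcases hs.lt_or_eq with hs | rfl
    · obtain ⟨s', h1, h2, -⟩ := h.nbr s hs k hk
      exact ⟨s', by omega, h1⟩
    · exact hext k hk
  have hbij : Function.Bijective (fun s : Fin (t + 1) => v s) := by
    refine ⟨fun s s' hs => Fin.ext (h.inj s (by omega) s' (by omega) hs), fun k => ?_⟩
    obtain ⟨s, hs, rfl⟩ := hall k
    exact ⟨⟨s, by omega⟩, rfl⟩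
  -- entries strictly above the first off-diagonal, together with their transposes, vanish
  have hfar : ∀ s s', s' ≤ t → s + 1 < s' → A (v s) (v s') = 0 ∧ A (v s') (v s) = 0 := by
    intro s s' hs' hss
    have h0 : A (v s') (v s) = 0 := by
      by_contra hne
      obtain ⟨r, h1, h2, -⟩ := h.nbr s (by omega) _ hne
      have := h.inj s' hs' r (by omega) h1
      omega
    exact ⟨hsymm _ _ h0, h0⟩
  refine ⟨t + 1, (Equiv.ofBijective _ hbij).symm, ?_⟩
  ext s s'
  rw [Matrix.reindex_apply, Matrix.submatrix_apply, Equiv.symm_symm]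
  change A (v s) (v s') = _
  simp only [CartanMatrix.A, Matrix.of_apply, Fin.ext_iff]
  rcases lt_trichotomy (s : ℕ) s' with hs | hs | hs
  · rw [if_neg hs.ne]
    split_ifs with h1
    · rw [show (s' : ℕ) = s + 1 by omega]
      exact (h.adj s (by omega)).1
    · exact (hfar s s' (by omega) (by omega)).1
  · rw [if_pos hs, hs, hdiag]
  · rw [if_neg hs.ne']
    split_ifs with h1
    · rw [show (s : ℕ) = s' + 1 by omega]
      exact (h.adj s' (by omega)).2
    · exact (hfar s' s (by omega) (by omega)).2

variable [Fintype κ]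

lemma sum_mul_le (hoff : ∀ l k, l ≠ k → A l k ≤ 0) (hm : ∀ l, 1 ≤ m l) {k : κ} {s : Finset κ}
    (hk : k ∈ s) : ∑ l, m l * A l k ≤ ∑ l ∈ s, m l * A l k := by
  classical
  rw [← Finset.sum_add_sum_compl s]
  refine add_le_of_nonpos_right (Finset.sum_nonpos fun l hl => ?_)
  have hne : l ≠ k := by
    rintro rfl
    exact Finset.mem_compl.1 hl hk
  exact mul_nonpos_of_nonneg_of_nonpos (by linarith [hm l]) (hoff l k hne)

/-- Let `m` be a vector of positive labels on a connected diagram, whose weighted column sums are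
nonnegative, and positive at two vertices `i ≠ j`. If `m i = 1`, then the diagram is of type `A`:
starting from `i`, positivity of the column sums forces a path whose only possible end is `j`. -/
theorem exists_reindex_eq_cartanMatrix_A (hdiag : ∀ l, A l l = 2)
    (hoff : ∀ l k, l ≠ k → A l k ≤ 0) (hsymm : ∀ l k, A l k = 0 → A k l = 0)
    (hconn : ∀ p : κ → Prop, p i → (∀ l k, p l → A k l ≠ 0 → p k) → ∀ k, p k)
    (hm : ∀ l, 1 ≤ m l) (hcol : ∀ k, 0 ≤ ∑ l, m l * A l k) (hij : i ≠ j) (hmi : m i = 1)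
    (hi : 1 ≤ ∑ l, m l * A l i) (hj : 1 ≤ ∑ l, m l * A l j) :
    ∃ (n : ℕ) (e : κ ≃ Fin n), A.reindex e e = CartanMatrix.A n := by
  classical
  by_contra hcon
  have hpath : ∀ t, ∃ v, IsDiagramPath A m i j v t := by
    intro t
    induction t with
    | zero =>
      refine ⟨fun _ => i, rfl, fun s hs s' hs' _ => by omega, fun s _ => hmi, ?_, ?_, ?_⟩ <;>
      · intro s hs
        omega
    | succ t ih =>
      obtain ⟨v, h⟩ := ih
      have hex : ∃ l, A l (v t) ≠ 0 ∧ ∀ s ≤ t, l ≠ v s := by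
        by_contra! hex
        exact hcon (h.exists_equiv hdiag hsymm hconn hex)
      obtain ⟨l, hl, hlv⟩ := hex
      -- the neighbours of `v t` outside the path contribute at least `-1` to the column sum,
      -- and at least `0` if `v t = j`
      have hout : ∀ r : Finset κ, (∀ k ∈ r, ∀ s ≤ t, k ≠ v s) →
          -1 ≤ ∑ k ∈ r, m k * A k (v t) ∧ (v t = j → 0 ≤ ∑ k ∈ r, m k * A k (v t)) := by
        intro r hr
        have ht : v t ∉ r := fun h' => hr _ h' t le_rfl rfl
        rcases t with _ | t
        · have h1 := sum_mul_le hoff hm (Finset.mem_insert_self (v 0) r)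
          rw [Finset.sum_insert ht, hdiag, h.label 0 le_rfl, h.zero] at h1
          rw [h.zero]
          exact ⟨by linarith, fun h' => absurd h' hij⟩
        · have ht' : v t ∉ r := fun h' => hr _ h' t (by omega) rfl
          have hne : v (t + 1) ∉ insert (v t) r := by
            rw [Finset.mem_insert, not_or]
            refine ⟨fun h' => ?_, ht⟩
            have := h.inj _ le_rfl _ (by omega) h'
            omega
          have h1 := sum_mul_le hoff hm (Finset.mem_insert_self (v (t + 1)) (insert (v t) r))
          rw [Finset.sum_insert hne, Finset.sum_insert ht', hdiag, h.label _ le_rfl,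
            h.label t (by omega), (h.adj t (by omega)).1] at h1
          refine ⟨by linarith [hcol (v (t + 1))], fun h' => ?_⟩
          rw [← h'] at hj
          linarith
      have hlt : l ≠ v t := hlv t le_rfl
      have hA1 : A l (v t) ≤ -1 := by
        have := hoff l (v t) hlt
        omega
      have hl1 := hout {l} (by simpa using hlv)
      rw [Finset.sum_singleton] at hl1
      have hml : m l = 1 := by nlinarith [hm l, hl1.1]
      have hA2 : A l (v t) = -1 := by
        have := hl1.1
        rw [hml] at this
        omega
      have hvj : v t ≠ j := by
        intro h'
        have := hl1.2 h'
        rw [hml, hA2] at this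
        omega
      have hnbr : ∀ k, A k (v t) ≠ 0 → (∀ s ≤ t, k ≠ v s) → k = l := by
        intro k hk hkv
        by_contra hne
        have h2 := (hout {k, l} (by
          intro k' hk'
          rw [Finset.mem_insert, Finset.mem_singleton] at hk'
          rcases hk' with rfl | rfl
          · exact hkv
          · exact hlv)).1
        rw [Finset.sum_pair hne, hml, hA2] at h2
        have h3 := hoff k (v t) (hkv t le_rfl)
        have h4 : A k (v t) ≤ -1 := by omega
        nlinarith [hm k]
      have hnbr' : ∀ k, A k (v t) ≠ 0 → k = l ∨ ∃ s, k = v s ∧ s ≤ t ∧ t ≤ s + 1 := by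
        intro k hk
        by_cases hkv : ∀ s ≤ t, k ≠ v s
        · exact Or.inl (hnbr k hk hkv)
        · push Not at hkv
          obtain ⟨s, hs, rfl⟩ := hkv
          refine Or.inr ⟨s, rfl, hs, ?_⟩
          by_contra hlt'
          obtain ⟨r, h1, h2, -⟩ := h.nbr s (by omega) (v t) fun h0 => hk (hsymm _ _ h0)
          have := h.inj t le_rfl r (by omega) h1
          omega
      have hA3 : A (v t) l ≤ -1 := by
        have h1 := hoff (v t) l hlt.symm
        have h2 : A (v t) l ≠ 0 := fun h0 => hl (hsymm _ _ h0)
        omega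
      have hA4 : A (v t) l = -1 := by
        by_contra hne
        have hsum := sum_mul_le hoff hm (k := l) (s := {l, v t}) (by simp)
        rw [Finset.sum_pair hlt, hdiag, hml, h.label t le_rfl] at hsum
        have hlj : l ≠ j := by
          rintro rfl
          omega
        -- a double bond exhausts the column sum at `l`, so the path closes up without meeting `j`
        have hclosed : ∀ k, A k l ≠ 0 → k = l ∨ k = v t := by
          intro k hk
          by_contra! hk'
          have hsum := sum_mul_le hoff hm (k := l) (s := {k, l, v t}) (by simp)
          rw [Finset.sum_insert (by simp [hk']), Finset.sum_pair hlt, hdiag, hml,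
            h.label t le_rfl] at hsum
          have h3 := hoff k l hk'.1
          have h4 : A k l ≤ -1 := by omega
          have h5 : A (v t) l ≤ -2 := by omega
          nlinarith [hm k, hcol l]
        have hall : ∀ k, k = l ∨ ∃ s ≤ t, k = v s := by
          refine hconn _ (Or.inr ⟨0, Nat.zero_le _, h.zero.symm⟩) ?_
          rintro _ k (rfl | ⟨s, hs, rfl⟩) hk
          · rcases hclosed k hk with h' | h'
            · exact Or.inl h'
            · exact Or.inr ⟨t, le_rfl, h'⟩
          · rcases hs.lt_or_eq with hs | rfl
            · obtain ⟨s', h1, h2, -⟩ := h.nbr s hs k hk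
              exact Or.inr ⟨s', by omega, h1⟩
            · rcases hnbr' k hk with h' | ⟨s', h1, h2, -⟩
              · exact Or.inl h'
              · exact Or.inr ⟨s', h2, h1⟩
        rcases hall j with h' | ⟨s, hs, h'⟩
        · exact hlj h'.symm
        · rcases hs.lt_or_eq with hs | rfl
          · exact h.ne s hs h'.symm
          · exact hvj h'.symm
      have hv' : ∀ s ≤ t, (if s ≤ t then v s else l) = v s := fun s hs => if_pos hs
      have hv'' : (if t + 1 ≤ t then v (t + 1) else l) = l := if_neg (by omega)
      refine ⟨fun s => if s ≤ t then v s else l, by simp [h.zero], ?_, ?_, ?_, ?_, ?_⟩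
      · intro s hs s' hs' hss
        rcases hs.lt_or_eq with hs | rfl
        · rcases hs'.lt_or_eq with hs' | rfl
          · rw [hv' s (by omega), hv' s' (by omega)] at hss
            exact h.inj s (by omega) s' (by omega) hss
          · rw [hv' s (by omega), hv''] at hss
            exact absurd hss.symm (hlv s (by omega))
        · rcases hs'.lt_or_eq with hs' | rfl
          · rw [hv' s' (by omega), hv''] at hss
            exact absurd hss (hlv s' (by omega))
          · rfl
      · intro s hs
        rcases hs.lt_or_eq with hs | rfl
        · rw [hv' s (by omega)]
          exact h.label s (by omega)
        · rw [hv'']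
          exact hml
      · intro s hs
        rw [hv' s (by omega)]
        rcases (Nat.lt_succ_iff.1 hs).lt_or_eq with hs | rfl
        · rw [hv' (s + 1) (by omega)]
          exact h.adj s hs
        · rw [hv'']
          exact ⟨hA4, hA2⟩
      · intro s hs k hk
        rw [hv' s (by omega)] at hk
        rcases (Nat.lt_succ_iff.1 hs).lt_or_eq with hs | rfl
        · obtain ⟨s', h1, h2, h3⟩ := h.nbr s hs k hk
          exact ⟨s', by rw [hv' s' (by omega)]; exact h1, h2, h3⟩
        · rcases hnbr' k hk with h' | ⟨s', h1, h2, h3⟩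
          · exact ⟨s + 1, by rw [hv'']; exact h', le_rfl, by omega⟩
          · exact ⟨s', by rw [hv' s' h2]; exact h1, by omega, h3⟩
      · intro s hs
        rw [hv' s (by omega)]
        rcases (Nat.lt_succ_iff.1 hs).lt_or_eq with hs | rfl
        · exact h.ne s hs
        · exact hvj
  obtain ⟨v, h⟩ := hpath (Fintype.card κ)
  have h1 := Fintype.card_le_of_injective (fun s : Fin (Fintype.card κ + 1) => v s)
    fun s s' hs => Fin.ext (h.inj s (by omega) s' (by omega) hs)
  rw [Fintype.card_fin] at h1
  omega

end Chain

/-! ### An elliptic element with eigenvalue `-1` outside type `A` -/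

section HighestRoot

variable {ι V N : Type*} [NormedAddCommGroup V] [InnerProductSpace ℝ V]
  [AddCommGroup N] [Module ℝ N] {P : RootPairing ι ℝ V N}

lemma prod_reflection_sub_mem (l : List ι) (v : V) :
    (l.map P.reflection).prod v - v ∈ Submodule.span ℝ (P.root '' {k | k ∈ l}) := by
  induction l with
  | nil => simp
  | cons k l ih =>
    have h1 : Submodule.span ℝ (P.root '' {x | x ∈ l})
        ≤ Submodule.span ℝ (P.root '' {x | x ∈ k :: l}) :=
      Submodule.span_mono (Set.image_mono fun x hx => List.mem_cons_of_mem _ hx)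
    rw [List.map_cons, List.prod_cons, LinearEquiv.mul_apply, P.reflection_apply, sub_right_comm]
    refine Submodule.sub_mem _ (h1 ih) (Submodule.smul_mem _ _ (Submodule.subset_span ?_))
    exact ⟨k, List.mem_cons_self, rfl⟩

/-- A product of reflections in linearly independent roots fixes only the vectors fixed by each
factor. -/
lemma coroot'_eq_zero_of_prod_reflection_eq {l : List ι}
    (hl : ∀ l₁ k l₂, l = l₁ ++ k :: l₂ →
      P.root k ∉ Submodule.span ℝ (P.root '' {x | x ∈ l₂}))
    {v : V} (hv : (l.map P.reflection).prod v = v) : ∀ k ∈ l, P.coroot' k v = 0 := by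
  induction l with
  | nil => simp
  | cons k l ih =>
    have h1 := prod_reflection_sub_mem (P := P) l v
    rw [List.map_cons, List.prod_cons, LinearEquiv.mul_apply, P.reflection_apply,
      sub_eq_iff_eq_add'] at hv
    set u := (l.map P.reflection).prod v with hu
    have h2 : P.coroot' k u = 0 := by
      by_contra h0
      have h3 : u - v = P.coroot' k u • P.root k := sub_eq_iff_eq_add.2 hv
      rw [h3] at h1
      exact hl [] k l rfl ((Submodule.smul_mem_iff _ h0).1 h1)
    rw [h2, zero_smul, zero_add] at hv
    intro k' hk'
    rcases List.mem_cons.1 hk' with rfl | hk'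
    · rwa [hv] at h2
    · exact ih (fun l₁ k' l₂ h => hl (k :: l₁) k' l₂ (by rw [h]; rfl)) hv k' hk'

lemma prod_reflection_eq_self {l : List ι} {v : V} (hv : ∀ k ∈ l, P.coroot' k v = 0) :
    (l.map P.reflection).prod v = v := by
  induction l with
  | nil => rfl
  | cons k l ih =>
    rw [List.map_cons, List.prod_cons, LinearEquiv.mul_apply,
      ih fun x hx => hv x (List.mem_cons_of_mem _ hx), P.reflection_apply,
      hv k List.mem_cons_self, zero_smul, sub_zero]

variable [P.IsRootSystem]

/-- An elliptic product of reflections negating the root `t`, if `t` is orthogonal to all simple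
roots but one. -/
lemma exists_elliptic_of_pairing_eq_zero
    (hinv : ∀ (i : ι) (x y : V), inner ℝ (P.reflection i x) (P.reflection i y) = inner ℝ x y)
    (b : P.Base) {t i : ι} (ht : ∀ k ∈ b.support, k ≠ i → P.pairing k t = 0) :
    ∃ w ∈ weyl P, (∀ v, w v = v → v = 0) ∧ w (P.root t) = -P.root t := by
  classical
  have hinner : ∀ k v, P.coroot' k v = 0 ↔ inner ℝ (P.root k) v = (0 : ℝ) := by
    intro k v
    have h0 : inner ℝ (P.root k) (P.root k) ≠ (0 : ℝ) := inner_self_ne_zero.2 (P.ne_zero k)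
    rw [coroot'_eq P hinv, div_eq_zero_iff, or_iff_left h0, mul_eq_zero, or_iff_right two_ne_zero]
  have horth : ∀ k ∈ b.support, k ≠ i → inner ℝ (P.root k) (P.root t) = (0 : ℝ) := by
    intro k hk hki
    rw [real_inner_comm, ← hinner]
    exact ht k hk hki
  let l := (b.support.erase i).toList
  have hmem : ∀ k, k ∈ l ↔ k ≠ i ∧ k ∈ b.support := fun k => by simp [l]
  -- the root `t` is orthogonal to the other simple roots, hence not in their span
  have hspan : P.root t ∉ Submodule.span ℝ (P.root '' {k | k ∈ l}) := by
    intro h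
    have h1 : Submodule.span ℝ (P.root '' {k | k ∈ l})
        ≤ LinearMap.ker (innerₗ V (P.root t)) := by
      rw [Submodule.span_le]
      rintro _ ⟨k, hk, rfl⟩
      rw [SetLike.mem_coe, LinearMap.mem_ker, innerₗ_apply_apply, real_inner_comm]
      exact horth k ((hmem k).1 hk).2 ((hmem k).1 hk).1
    exact P.ne_zero t (inner_self_eq_zero.1 (h1 h))
  refine ⟨((t :: l).map P.reflection).prod, ?_, fun v hv => ?_, ?_⟩
  · refine Subgroup.list_prod_mem _ fun w hw => ?_
    obtain ⟨k, -, rfl⟩ := List.mem_map.1 hw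
    exact Subgroup.subset_closure ⟨k, rfl⟩
  · have h1 : ∀ k ∈ t :: l, P.coroot' k v = 0 := by
      refine coroot'_eq_zero_of_prod_reflection_eq (fun l₁ k l₂ h => ?_) hv
      rcases List.cons_eq_append_iff.1 h with ⟨rfl, h⟩ | ⟨l₁', rfl, h⟩
      · obtain ⟨rfl, rfl⟩ := List.cons.inj h
        exact hspan
      · replace h : l = l₁' ++ k :: l₂ := (List.cons.inj h).2
        have hnd : (l₁' ++ k :: l₂).Nodup := h ▸ Finset.nodup_toList _
        have hk : k ∉ l₂ := (List.nodup_cons.1 (List.nodup_append.1 hnd).2.1).1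
        have hkl : ∀ x, x ∈ k :: l₂ → x ∈ b.support := fun x hx =>
          ((hmem x).1 (h ▸ List.mem_append_right _ hx)).2
        have h2 := b.linearIndepOn_root.mono (t := {x | x ∈ k :: l₂}) hkl
        intro h3
        have h4 := (linearIndepOn_insert (K := ℝ) (f := P.root) (s := {x | x ∈ l₂}) hk).1 (by
          have h5 : insert k {x | x ∈ l₂} = {x | x ∈ k :: l₂} := by
            ext x
            simp
          rwa [h5])
        exact h4.2 h3
    refine eq_zero_of_coroot'_eq_zero b fun k hk => ?_
    rcases eq_or_ne k i with rfl | hki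
    swap
    · exact h1 k (List.mem_cons_of_mem _ ((hmem k).2 ⟨hki, hk⟩))
    obtain ⟨f, -, -, hf⟩ := b.exists_root_eq_sum_int t
    rw [← Finset.add_sum_erase _ _ hk] at hf
    have h2 : P.coroot' t v = 0 := h1 t List.mem_cons_self
    rw [hinner] at h2 ⊢
    rw [hf, inner_add_left, sum_inner, Finset.sum_eq_zero, add_zero,
      ← Int.cast_smul_eq_zsmul ℝ, real_inner_smul_left] at h2
    · refine (mul_eq_zero.1 h2).resolve_left fun h3 => hspan ?_
      rw [hf, Int.cast_eq_zero.1 h3, zero_smul, zero_add]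
      refine Submodule.sum_mem _ fun x hx => ?_
      rw [← Int.cast_smul_eq_zsmul ℝ]
      exact Submodule.smul_mem _ _ (Submodule.subset_span ⟨x, by simpa [l] using hx, rfl⟩)
    · intro x hx
      rw [← Int.cast_smul_eq_zsmul ℝ, real_inner_smul_left,
        (hinner x v).1 (h1 x (List.mem_cons_of_mem _ (by simpa [l] using hx))), mul_zero]
  · rw [List.map_cons, List.prod_cons, LinearEquiv.mul_apply, prod_reflection_eq_self,
      P.reflection_apply_self]
    intro k hk
    rw [hinner]
    exact horth k ((hmem k).1 hk).2 ((hmem k).1 hk).1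

/-- Outside type `A`, some elliptic element of an irreducible Weyl group has the eigenvalue `-1`.
Let `θ` be the highest root. If only one simple root is not orthogonal to `θ`, the product of the
reflections in `θ` and in the other simple roots works; otherwise the coefficients of `θ` force
the diagram to be of type `A`. -/
theorem exists_elliptic_of_not_isTypeA [Finite ι] [P.IsCrystallographic] [P.IsReduced]
    [P.IsIrreducible]
    (hinv : ∀ (i : ι) (x y : V), inner ℝ (P.reflection i x) (P.reflection i y) = inner ℝ x y)
    (hA : ¬ IsTypeA P) :
    ∃ w ∈ weyl P, (∀ v, w v = v → v = 0) ∧ ∃ θ, θ ≠ 0 ∧ w θ = -θ := by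
  classical
  have hne : Nonempty ι := by
    by_contra h
    rw [not_nonempty_iff] at h
    have h1 := RootPairing.IsRootSystem.span_root_eq_top (P := P)
    rw [Set.range_eq_empty, Submodule.span_empty] at h1
    have := RootPairing.IsIrreducible.nontrivial P
    exact bot_ne_top h1
  obtain ⟨b⟩ := P.nonempty_base
  obtain ⟨t, ht⟩ := Finite.exists_max b.height
  by_contra hcon
  have hq : ∀ k ∈ b.support, 0 ≤ P.pairingIn ℤ t k := by
    intro k hk
    by_contra! hneg
    have h1 : b.height (P.reflectionPerm k t)
        = b.height t + (-P.pairingIn ℤ t k) • b.height k := by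
      refine b.height_add_zsmul ?_
      rw [P.root_reflectionPerm, P.reflection_apply_root, neg_smul, ← sub_eq_add_neg,
        ← P.algebraMap_pairingIn ℤ, ← Int.cast_smul_eq_zsmul ℝ]
      rfl
    rw [b.height_one_of_mem_support hk] at h1
    have := ht (P.reflectionPerm k t)
    simp only [smul_eq_mul, mul_one] at h1
    omega
  have hpq : ∀ k, 0 < P.pairingIn ℤ k t ↔ 0 < P.pairingIn ℤ t k := fun k =>
    P.zero_lt_pairingIn_iff' ℤ
  have hp : ∀ k ∈ b.support, 0 ≤ P.pairingIn ℤ k t := by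
    intro k hk
    rw [← not_lt, P.pairingIn_lt_zero_iff ℤ, not_lt]
    exact hq k hk
  have hcast : ∀ k l, ((P.pairingIn ℤ k l : ℤ) : ℝ) = P.coroot' l (P.root k) := fun k l =>
    P.algebraMap_pairingIn ℤ k l
  obtain ⟨m, hm⟩ : ∃ m : ι → ℕ, P.root t = ∑ k ∈ b.support, m k • P.root k := by
    obtain ⟨m, -, hm | hm⟩ := b.exists_root_eq_sum_nat_or_neg t
    · exact ⟨m, hm⟩
    · have h1 : (2 : ℝ) = -∑ k ∈ b.support, (m k : ℝ) * (P.pairingIn ℤ k t : ℤ) := by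
        rw [← P.root_coroot_two t]
        change P.coroot' t (P.root t) = _
        rw [hm]
        simp [hcast]
      have h2 : (0 : ℝ) ≤ ∑ k ∈ b.support, (m k : ℝ) * (P.pairingIn ℤ k t : ℤ) :=
        Finset.sum_nonneg fun k hk => mul_nonneg (Nat.cast_nonneg _) (by exact_mod_cast hp k hk)
      linarith
  have hsum : ∀ l, P.pairingIn ℤ t l = ∑ k : b.support, (m k : ℤ) * P.pairingIn ℤ k l := by
    intro l
    have h1 : ((P.pairingIn ℤ t l : ℤ) : ℝ)
        = ∑ k : b.support, (m k : ℝ) * (P.pairingIn ℤ k l : ℤ) := by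
      rw [Finset.sum_coe_sort b.support fun k => (m k : ℝ) * (P.pairingIn ℤ k l : ℤ), hcast, hm]
      simp [hcast]
    exact_mod_cast h1
  have hoff : ∀ k l : b.support, k ≠ l → b.cartanMatrix k l ≤ 0 := b.cartanMatrix_le_zero_of_ne
  have hconn : ∀ (i : b.support) (p : b.support → Prop), p i →
      (∀ l k, p l → b.cartanMatrix k l ≠ 0 → p k) → ∀ k, p k := fun i p hi h k =>
    b.induction_on_cartanMatrix p hi h
  -- by connectedness all simple roots occur in the highest root
  have hm1 : ∀ k : b.support, 1 ≤ (m k : ℤ) := by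
    have h2 : ∃ k : b.support, m k ≠ 0 := by
      by_contra! h0
      have := hsum t
      simp [h0] at this
    obtain ⟨i, hi⟩ := h2
    have h3 : ∀ k : b.support, m k ≠ 0 := by
      refine hconn i _ hi fun l k hl hkl hk => ?_
      have h4 := hsum k
      have h5 : ∀ x : b.support, (m x : ℤ) * P.pairingIn ℤ x k ≤ 0 := by
        intro x
        rcases eq_or_ne x k with rfl | hxk
        · simp [hk]
        · exact mul_nonpos_of_nonneg_of_nonpos (by positivity) (hoff x k hxk)
      have h6 : (m l : ℤ) * P.pairingIn ℤ l k < 0 := by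
        refine lt_of_le_of_ne (h5 l) (mul_ne_zero (by exact_mod_cast hl) fun h0 => hkl ?_)
        exact b.cartanMatrix_apply_eq_zero_iff_symm.1 h0
      have h7 := Finset.sum_lt_sum (fun x _ => h5 x) ⟨l, Finset.mem_univ _, h6⟩
      rw [Finset.sum_const_zero, ← h4] at h7
      exact absurd (hq k k.2) (not_le.2 h7)
    intro k
    have := h3 k
    omega
  have htwo := hsum t
  rw [P.pairingIn_same] at htwo
  have hnot : ∀ i : b.support, ∃ j : b.support, j ≠ i ∧ 1 ≤ P.pairingIn ℤ j t := by
    intro i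
    by_contra! h0
    refine hcon ?_
    obtain ⟨w, hw, h1, h2⟩ := exists_elliptic_of_pairing_eq_zero hinv b (t := t) (i := i)
      fun k hk hki => by
        have h3 := h0 ⟨k, hk⟩ fun h => hki (congrArg Subtype.val h)
        have h4 : P.pairingIn ℤ k t = 0 := le_antisymm (by simpa using Int.lt_add_one_iff.1 h3)
          (hp k hk)
        rw [← P.algebraMap_pairingIn ℤ, h4, map_zero]
    exact ⟨w, hw, h1, P.root t, P.ne_zero t, h2⟩
  obtain ⟨i₀⟩ : Nonempty b.support := b.support_nonempty.coe_sort
  obtain ⟨i, -, hi⟩ := hnot i₀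
  obtain ⟨j, hji, hj⟩ := hnot i
  have hmi : (m i : ℤ) = 1 := by
    have h1 : ∑ k ∈ {j, i}, (m k : ℤ) * P.pairingIn ℤ k t
        ≤ ∑ k : b.support, (m k : ℤ) * P.pairingIn ℤ k t :=
      Finset.sum_le_sum_of_subset_of_nonneg (Finset.subset_univ _) fun k _ _ =>
        mul_nonneg (by positivity) (hp k k.2)
    rw [← htwo, Finset.sum_pair hji] at h1
    nlinarith [hm1 i, hm1 j]
  refine hA ⟨b, exists_reindex_eq_cartanMatrix_A (m := fun k => (m k : ℤ)) (i := i) (j := j)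
    b.cartanMatrix_apply_same hoff
    (fun l k h => b.cartanMatrix_apply_eq_zero_iff_symm.1 h) (hconn i) hm1 (fun k => ?_)
    hji.symm hmi ?_ ?_⟩
  · exact (hq k k.2).trans_eq (hsum k)
  · exact ((hpq i).1 hi).trans_eq (hsum i)
  · exact ((hpq j).1 hj).trans_eq (hsum j)

end HighestRoot

end SpinWeyl

end

theorem mainTheorem4 {ι V N S : Type*} [Finite ι]
    [NormedAddCommGroup V] [InnerProductSpace ℝ V] [FiniteDimensional ℝ V]
    [AddCommGroup N] [Module ℝ N]
    (P : RootPairing ι ℝ V N) [P.IsRootSystem] [P.IsCrystallographic] [P.IsReduced]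
    (hinv : ∀ (i : ι) (x y : V), inner ℝ (P.reflection i x) (P.reflection i y) = inner ℝ x y)
    [AddCommGroup S] [Module ℂ S] [FiniteDimensional ℂ S]
    (γ : SpinWeyl.Cl V →ₐ[ℝ] Module.End ℂ S) (hS : SpinWeyl.IsSpinModule γ) :
    ∃ φ : SpinWeyl.RbarW P →ₗ[ℂ] SpinWeyl.RbarGen P,
      (∀ σ : SpinWeyl.repSpace (SpinWeyl.weyl P),
        (φ (Submodule.Quotient.mk σ) : SpinWeyl.RbarCover P) =
          Submodule.Quotient.mk (SpinWeyl.tensorS P γ σ)) ∧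
      (Odd (Module.finrank ℝ V) → Function.Bijective φ) ∧
      (P.IsIrreducible →
        (Function.Bijective φ ↔ (Odd (Module.finrank ℝ V) ∨ SpinWeyl.IsTypeA P))) := by
  have hodd : Odd (Module.finrank ℝ V) → Function.Bijective (SpinWeyl.tensorBar P γ) := fun hn =>
    SpinWeyl.bijective_tensorBar hinv fun g hg =>
      SpinWeyl.character_ne_zero_of_odd hinv hS hn hg
  refine ⟨SpinWeyl.tensorBar P γ, SpinWeyl.tensorBar_mk γ, hodd, fun _ => ⟨fun h => ?_, ?_⟩⟩
  · by_contra! hcon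
    obtain ⟨hn, hA⟩ := hcon
    rw [Nat.not_odd_iff_even] at hn
    obtain ⟨w, hw, hell, θ, hθ, hwθ⟩ := SpinWeyl.exists_elliptic_of_not_isTypeA hinv hA
    obtain ⟨g, hg⟩ := SpinWeyl.coverProj_surjective hinv ⟨w, hw⟩
    have hgw : SpinWeyl.coverAction P g = w := congrArg Subtype.val hg
    have hdet : LinearMap.det (SpinWeyl.coverAction P g : V →ₗ[ℝ] V) = 1 := by
      rw [hgw, SpinWeyl.det_eq_neg_one_pow (SpinWeyl.inner_weyl hinv hw) hell, hn.neg_one_pow]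
    rw [← hgw] at hell hwθ
    exact SpinWeyl.character_ne_zero_of_injective_tensorBar hinv h.1 hell
      (SpinWeyl.character_eq_zero hinv γ hdet hθ hwθ)
  · rintro (hn | hA)
    · exact hodd hn
    rcases Nat.even_or_odd (Module.finrank ℝ V) with hn | hn
    · refine SpinWeyl.bijective_tensorBar hinv fun g hg =>
        SpinWeyl.character_ne_zero_of_even hinv hS hn hg fun v hv => ?_
      exact SpinWeyl.eq_zero_of_isTypeA hA hn (SpinWeyl.coverProj P g).2 hg hv
    · exact hodd hn
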